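/- Let $A=(a_{ij})_{0\le i,j\le n}$ be an irreducible affine Cartan matrix (twisted or untwisted), with marks $a_0,\dots,a_n$ (the coprime positive integers with $\sum_j a_{ij}a_j=0$ for all $i$). Let $V=\mathbb R^{n+1}$ be the coweight space, with coordinates $x_j=\langle x,\alpha_j\rangle$, and let $\alpha_i^\vee\in V$ be the simple coroots, $\langle\alpha_i^\vee,\alpha_j\rangle=a_{ij}$. Let $W\subset GL(V)$ be the affine Weyl group, generated by $s_i(x)=x-\langle x,\alpha_i\rangle\alpha_i^\vee$ for $0\le i\le n$. The group $W$ stabilizes the level $0$ space $V^0=\{x:\sum_j a_jx_j=0\}$. Let $\mathrm{cl}:W\to GL(V^0)$ be the restriction map, let $\mathring W=\mathrm{cl}(W)$ be the associated finite Weyl group, and let $\mathrm{cl}(\alpha_i)$ be the linear form $x\mapsto x_i$ on $V^0$. Assume, as usual, that the nodes are labelled so that $\mathring W$ is generated by $\mathrm{cl}(s_1),\dots,\mathrm{cl}(s_n)$. Call a linear form on $V^0$ positive if it is positive on the fundamental chamber $\{x\in V^0: x_i>0 \text{ for } i=1,\dots,n\}$, and let $\mathring W$ act on linear forms by $(w\varphi)(x)=\varphi(w^{-1}x)$.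 For $0\le i\le n$ let $\pi_i$ be the projection associated to $\mathrm{cl}(\alpha_i)$, that is, the linear operator on $\mathbb C\mathring W$ (acting on the right) with $$w.\pi_i=\begin{cases} w\,\mathrm{cl}(s_i) & \text{if } w(\mathrm{cl}(\alpha_i)) \text{ is positive},\\ w & \text{otherwise.}\end{cases}$$ The Hecke group algebra of $\mathring W$ is the smallest (unital) subalgebra of $\mathrm{End}_{\mathbb C}(\mathbb C\mathring W)$ that contains both the $0$-Hecke algebra of $\mathring W$ (generated by $\pi_1,\dots,\pi_n$) and the group algebra of $\mathring W$ acting by right multiplication. Then: 1. The Hecke group algebra of $\mathring W$ is generated as an algebra by $\pi_0,\pi_1,\dots,\pi_n$. 2. Alternatively, $\pi_0$ may be replaced by any $\Omega\in W$ that maps, at level $0$, $\alpha_0$ to some simple root of $\mathring W$ up to a positive scalar: if $\mathrm{cl}(\Omega)(\mathrm{cl}(\alpha_0))=c\,\mathrm{cl}(\alpha_i)$ for some $i\in\{1,\dots,n\}$ and some real $c>0$, then the Hecke group algebra of $\mathring W$ is generated as an algebra by $\pi_1,\dots,\pi_n$ and the operator of right multiplication by $\mathrm{cl}(\Omega)$.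 -/

import Mathlib

/-- An irreducible affine Cartan matrix with rows and columns indexed by `{0, …, n}`: an
indecomposable generalized Cartan matrix that is symmetrizable to a positive semidefinite singular
matrix. The marks `a_j` are the positive coprime integers with `∑ j, A i j * a_j = 0` for all `i`
(the coefficients of the null root). -/
structure AffineCartanDatum (n : ℕ) where
  A : Matrix (Fin (n + 1)) (Fin (n + 1)) ℤ
  diag : ∀ i, A i i = 2
  nonpos : ∀ i j, i ≠ j → A i j ≤ 0
  zero_symm : ∀ i j, A i j = 0 → A j i = 0
  indecomposable : ∀ S : Set (Fin (n + 1)), S.Nonempty → Sᶜ.Nonempty →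
    ∃ i ∈ S, ∃ j ∈ Sᶜ, A i j ≠ 0
  posSemidef : ∃ d : Fin (n + 1) → ℝ, (∀ i, 0 < d i) ∧
    (Matrix.diagonal d * A.map (fun z : ℤ => (z : ℝ))).PosSemidef
  singular : A.det = 0
  mark : Fin (n + 1) → ℕ
  mark_pos : ∀ j, 0 < mark j
  mark_coprime : Finset.univ.gcd mark = 1
  mark_null : ∀ i, ∑ j, A i j * (mark j : ℤ) = 0

namespace AffineCartanDatum

variable {n : ℕ} (D : AffineCartanDatum n)

/-- The simple coroot `α_i^∨` in the coweight space `ℝ^{n+1}`, where a coweight `x` is given by its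
coordinates `x j = ⟨x, α_j⟩` on the fundamental coweights. -/
def coroot (i : Fin (n + 1)) : Fin (n + 1) → ℝ := fun j => (D.A i j : ℝ)

theorem proj_coroot (i : Fin (n + 1)) :
    (LinearMap.proj i : (Fin (n + 1) → ℝ) →ₗ[ℝ] ℝ) (D.coroot i) = 2 := by
  simp [coroot, D.diag]

/-- The simple reflection `s_i (x) = x - ⟨x, α_i⟩ α_i^∨` on the coweight space. -/
noncomputable def simpleReflection (i : Fin (n + 1)) :
    (Fin (n + 1) → ℝ) ≃ₗ[ℝ] (Fin (n + 1) → ℝ) :=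
  Module.reflection (D.proj_coroot i)

/-- The affine Weyl group `W`, acting on the coweight space. -/
def affineWeylGroup : Subgroup ((Fin (n + 1) → ℝ) ≃ₗ[ℝ] (Fin (n + 1) → ℝ)) :=
  Subgroup.closure (Set.range D.simpleReflection)

/-- The simple reflection `s_i` as an element of `W`. -/
noncomputable def s (i : Fin (n + 1)) : D.affineWeylGroup :=
  ⟨D.simpleReflection i, Subgroup.subset_closure ⟨i, rfl⟩⟩

/-- The level `⟨x, δ⟩` of a coweight `x`, where `δ = ∑ j, a_j α_j` is the null root. -/
noncomputable def level : (Fin (n + 1) → ℝ) →ₗ[ℝ] ℝ :=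
  ∑ j, (D.mark j : ℝ) • LinearMap.proj j

/-- The space of coweights of level `0`. -/
noncomputable def levelZero : Submodule ℝ (Fin (n + 1) → ℝ) := LinearMap.ker D.level

theorem level_coroot (i : Fin (n + 1)) : D.level (D.coroot i) = 0 := by
  have h := congrArg (fun z : ℤ => (z : ℝ)) (D.mark_null i)
  simp only [Int.cast_sum, Int.cast_mul, Int.cast_natCast, Int.cast_zero] at h
  simp only [level, coroot, LinearMap.sum_apply, LinearMap.smul_apply, LinearMap.proj_apply,
    smul_eq_mul]
  rw [← h]
  exact Finset.sum_congr rfl fun j _ => mul_comm _ _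

theorem level_apply_of_mem (w : (Fin (n + 1) → ℝ) ≃ₗ[ℝ] (Fin (n + 1) → ℝ))
    (hw : w ∈ D.affineWeylGroup) : ∀ x, D.level (w x) = D.level x := by
  induction hw using Subgroup.closure_induction with
  | mem w hw =>
    obtain ⟨i, rfl⟩ := hw
    intro x
    simp [simpleReflection, Module.reflection_apply, level_coroot]
  | one => intro x; rfl
  | mul a b _ _ ha hb => intro x; rw [LinearEquiv.mul_apply, ha, hb]
  | inv a _ ha =>
    intro x
    rw [← ha (a⁻¹ x), ← LinearEquiv.mul_apply, mul_inv_cancel]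
    rfl

theorem map_levelZero (w : D.affineWeylGroup) :
    D.levelZero.map ((w : (Fin (n + 1) → ℝ) ≃ₗ[ℝ] (Fin (n + 1) → ℝ)) :
      (Fin (n + 1) → ℝ) →ₗ[ℝ] (Fin (n + 1) → ℝ)) = D.levelZero := by
  ext x
  constructor
  · rintro ⟨y, hy, rfl⟩
    exact (D.level_apply_of_mem w w.2 y).trans hy
  · intro hx
    refine ⟨(w : (Fin (n + 1) → ℝ) ≃ₗ[ℝ] (Fin (n + 1) → ℝ)).symm x, ?_, ?_⟩
    · have h := D.level_apply_of_mem w w.2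
        ((w : (Fin (n + 1) → ℝ) ≃ₗ[ℝ] (Fin (n + 1) → ℝ)).symm x)
      rw [LinearEquiv.apply_symm_apply] at h
      exact h.symm.trans hx
    · simp

/-- The level `0` action of `W`: the restriction of `w` to the coweights of level `0`. -/
noncomputable def levelZeroAction : D.affineWeylGroup →* (D.levelZero ≃ₗ[ℝ] D.levelZero) where
  toFun w := LinearEquiv.ofSubmodules
    (w : (Fin (n + 1) → ℝ) ≃ₗ[ℝ] (Fin (n + 1) → ℝ)) D.levelZero D.levelZero (D.map_levelZero w)
  map_one' := by ext x; rfl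
  map_mul' a b := by ext x; rfl

/-- The finite Weyl group `W̊ = cl(W)`. -/
noncomputable def finiteWeylGroup : Subgroup (D.levelZero ≃ₗ[ℝ] D.levelZero) :=
  D.levelZeroAction.range

/-- The canonical quotient map `cl : W → W̊`. -/
noncomputable def cl : D.affineWeylGroup →* D.finiteWeylGroup := D.levelZeroAction.rangeRestrict

/-- The node `0` is appropriately labelled: `W̊` is generated by `cl(s_1), …, cl(s_n)`. -/
def IsProperlyLabelled : Prop :=
  Subgroup.closure ((fun i => D.cl (D.s i)) '' {i | i ≠ 0}) = ⊤

/-- The root `cl(α_i)`, as the linear form `x ↦ ⟨x, α_i⟩` on the coweights of level `0`. -/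
noncomputable def clRoot (i : Fin (n + 1)) : Module.Dual ℝ D.levelZero :=
  (LinearMap.proj i : (Fin (n + 1) → ℝ) →ₗ[ℝ] ℝ) ∘ₗ D.levelZero.subtype

/-- The action of `W̊` on linear forms: `⟨x, w(φ)⟩ = ⟨w⁻¹(x), φ⟩`. -/
noncomputable def rootAction (w : D.finiteWeylGroup) (φ : Module.Dual ℝ D.levelZero) :
    Module.Dual ℝ D.levelZero :=
  φ ∘ₗ (((w⁻¹ : D.finiteWeylGroup) : D.levelZero ≃ₗ[ℝ] D.levelZero) :
    D.levelZero →ₗ[ℝ] D.levelZero)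

/-- The (open) fundamental chamber of `W̊`. -/
def chamber : Set D.levelZero := {x | ∀ i, i ≠ 0 → 0 < D.clRoot i x}

/-- A linear form (for instance a root) is positive if it is positive on the fundamental chamber. -/
def IsPositive (φ : Module.Dual ℝ D.levelZero) : Prop := ∀ x ∈ D.chamber, 0 < φ x

open Classical in
/-- The right action of `π_i`, the projection associated to `cl(α_i)`, on `W̊`. The element `w`
stands for the chamber `w⁻¹(C)`, which is on the positive side of `cl(α_i)` if and only if
`w(cl(α_i))` is positive; it is then reflected to the negative side. -/
noncomputable def projAct (i : Fin (n + 1)) (w : D.finiteWeylGroup) : D.finiteWeylGroup :=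
  if D.IsPositive (D.rootAction w (D.clRoot i)) then w * D.cl (D.s i) else w

/-- The operator `π_i` on `ℂ.W̊`. -/
noncomputable def projOp (i : Fin (n + 1)) : Module.End ℂ (D.finiteWeylGroup →₀ ℂ) :=
  Finsupp.lmapDomain ℂ ℂ (D.projAct i)

/-- The operator of right multiplication by `v ∈ W̊` on `ℂ.W̊`. -/
noncomputable def rightMulOp (v : D.finiteWeylGroup) : Module.End ℂ (D.finiteWeylGroup →₀ ℂ) :=
  Finsupp.lmapDomain ℂ ℂ (fun w => w * v)

/-- The `0`-Hecke algebra of `W̊` in its right regular representation. -/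
noncomputable def zeroHeckeAlgebra : Subalgebra ℂ (Module.End ℂ (D.finiteWeylGroup →₀ ℂ)) :=
  Algebra.adjoin ℂ (D.projOp '' {i | i ≠ 0})

/-- The group algebra of `W̊` in its right regular representation. -/
noncomputable def groupAlgebra : Subalgebra ℂ (Module.End ℂ (D.finiteWeylGroup →₀ ℂ)) :=
  Algebra.adjoin ℂ (Set.range D.rightMulOp)

/-- The Hecke group algebra of `W̊`: the smallest subalgebra of `End(ℂ.W̊)` that contains both the
`0`-Hecke algebra and the group algebra. -/
noncomputable def heckeGroupAlgebra : Subalgebra ℂ (Module.End ℂ (D.finiteWeylGroup →₀ ℂ)) :=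
  D.zeroHeckeAlgebra ⊔ D.groupAlgebra

end AffineCartanDatum

/-!
The argument takes place in a finite reflection group `W` with simple reflections `s_j`, `j ≠ 0`,
and works with a third description of the Hecke group algebra: the algebra of all operators on
`ℂ.W` that preserve, for each simple `j`, the space `K_j` of vectors antisymmetric under *left*
multiplication by `s_j` (`ReflectionCombinatorics.typePreserving`). All the projections `π_i`,
including `π_0`, and all right multiplications belong to it. Conversely, it is contained in any
algebra that contains `π_j` for all simple `j` and is transitive enough
(`ReflectionCombinatorics.typePreserving_le`), for the following reasons.

* For `w ∈ W`, let `I` be the set of left descents of `w` and let `b_w = ∑_{u ∈ W_I} sign(u) u w`.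
  The `b_w` form a basis of `ℂ.W`, triangular for the length, and each `K_j` is spanned by those
  `b_w` that have `j` as a left descent (`antisymSpace_le`). So if `T` preserves all `K_j`, the
  functional `b_w^* ∘ T` is constant on the cosets `W_J x`, where `J` is the complement of `I`, and
  `T = ∑_w (b_w^* ∘ T) b_w` is a combination of operators
  `x ↦ [x ∈ W_J y] ∑_{u ∈ W_I} sign(u) u w` (`smulRight_mem_of_indicator_mem`).
* For `y = 1` and `w` the longest element, this operator lies in the `0`-Hecke algebra. Indeed the
  `0`-Hecke algebra commutes with the analogous left projections, which determines its elements
  from their value at `1` (`smulRight_indicator_mem_zeroHecke`).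
* The other values of `y` and `w` are reached by composing with `π_i` on either side along paths
  in the graph with edges `w → w.π_i` (`op_antisym`, `indicator_comp_op`).

It remains to see that `π_0, …, π_n` act transitively on `W`. Let `p` be a point of the fundamental
chamber. As `∑ a_i cl(α_i) = 0`, the numbers `a_i (w cl(α_i))(p)` add up to zero for each `w`; they
form a circulation that is positive along each edge `w → w.π_i`, and a finite graph that carries a
positive circulation has no one-way exits (`mem_of_closed_under_up`).

The rest is the classical theory of the finite Weyl group: it is finite because it permutes integer
vectors of bounded norm for a positive definite form, and a root is either positive or negative by
Tits' argument, which reduces this to rank two, where the Cartan integers leave six cases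
(`CoxeterWord.apply_root_mem_of_length_le`). For the root `cl(α_0)`, which need not be simple, one
uses that no nontrivial element fixes a point of the open chamber (`isPositive_or_neg`).

If `Ω` maps `cl(α_0)` to a positive multiple of `cl(α_i)`, then `π_0` is conjugate to `π_i` by right
multiplication by `cl(Ω)`, whose inverse is one of its powers (`projOp_eq_conj`).
-/

/-! ### Combinatorics of a finite reflection group -/

/-- The combinatorics of a finite reflection group `W` acting on a root system, as far as the
projections `π_i` see it. The family `s` consists of reflections, each attached to a root `α_i`;
those with `i ∈ simple` are the simple reflections, the others are arbitrary. No root appears in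
the structure: `Up i w` says that the root `w(α_i)` is positive, `len` is the length with respect
to the simple reflections, and `weight w i` is the value at a fixed point of the fundamental
chamber of `w(α_i)`, rescaled so that the rescaled roots add up to zero. -/
structure ReflectionCombinatorics (ι W : Type*) [Fintype ι] [Group W] where
  s : ι → W
  simple : Set ι
  Up : ι → W → Prop
  len : W → ℕ
  weight : W → ι → ℝ
  s_mul_self : ∀ i, s i * s i = 1
  up_mul_s : ∀ i w, Up i (w * s i) ↔ ¬ Up i w
  up_iff_len : ∀ i ∈ simple, ∀ w, Up i w ↔ len w < len (w * s i)
  len_mul_le : ∀ i ∈ simple, ∀ w, len (w * s i) ≤ len w + 1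
  len_inv : ∀ w, len w⁻¹ = len w
  exists_not_up : ∀ w, w ≠ 1 → ∃ i ∈ simple, ¬ Up i w
  /-- The folding condition: a simple reflection `s j` changes the sign of no positive root except
  the positive multiples of its own root. -/
  fold : ∀ j ∈ simple, ∀ i w, Up i w → ¬ Up i (s j * w) → s j * w = w * s i
  closure_simple : Subgroup.closure (s '' simple) = ⊤
  /-- The left descents of an element of a standard parabolic subgroup `W_I` belong to `I`. -/
  up_inv_of_mem_parabolic : ∀ I ⊆ simple, ∀ u ∈ Subgroup.closure (s '' I), ∀ i ∈ simple, i ∉ I →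
    Up i u⁻¹
  /-- If all elements of `I` are left descents of `x`, then `x` exchanges the left ascents and the
  left descents (in `I`) of the elements of `W_I`. -/
  up_inv_mul_iff : ∀ I ⊆ simple, ∀ x : W, (∀ i ∈ I, ¬ Up i x⁻¹) →
    ∀ u ∈ Subgroup.closure (s '' I), ∀ i ∈ I, (Up i (u * x)⁻¹ ↔ ¬ Up i u⁻¹)
  up_iff_weight : ∀ i w, Up i w ↔ 0 < weight w i
  weight_mul_s : ∀ i w, weight (w * s i) i = - weight w i
  weight_sum : ∀ w, ∑ i, weight w i = 0

namespace ReflectionCombinatorics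

variable {ι W : Type*} [Fintype ι] [Group W] (S : ReflectionCombinatorics ι W)

/-- The standard parabolic subgroup generated by the `s i`, `i ∈ I`. -/
def parabolic (I : Set ι) : Subgroup W := Subgroup.closure (S.s '' I)

open Classical in
/-- The projection `π_i` on `W`: the element `w` is moved to `w s_i` if `w(α_i)` is positive. -/
noncomputable def move (i : ι) (w : W) : W := if S.Up i w then w * S.s i else w

/-- The projection `π_i` as an operator on `ℂ.W`. -/
noncomputable def op (i : ι) : Module.End ℂ (W →₀ ℂ) := Finsupp.lmapDomain ℂ ℂ (S.move i)

/-- Right multiplication by `v` as an operator on `ℂ.W`. -/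
noncomputable def rightMul (v : W) : Module.End ℂ (W →₀ ℂ) :=
  Finsupp.lmapDomain ℂ ℂ (fun w => w * v)

/-- The index `j` is a left ascent of `w`: for simple `j`, this says that `s j * w` is longer than
`w`. -/
def LUp (j : ι) (w : W) : Prop := S.Up j w⁻¹

open Classical in
/-- The left-handed analogue of `move`: multiply by `s j` on the left at a left ascent `j`. -/
noncomputable def lmove (j : ι) (w : W) : W := if S.LUp j w then S.s j * w else w

/-- The left-handed analogue of `op`. -/
noncomputable def lop (j : ι) : Module.End ℂ (W →₀ ℂ) := Finsupp.lmapDomain ℂ ℂ (S.lmove j)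

theorem s_inv (i : ι) : (S.s i)⁻¹ = S.s i := inv_eq_of_mul_eq_one_left (S.s_mul_self i)

theorem s_mul_s_mul (i : ι) (w : W) : S.s i * (S.s i * w) = w := by
  rw [← mul_assoc, S.s_mul_self, one_mul]

theorem mul_s_mul_s (i : ι) (w : W) : w * S.s i * S.s i = w := by
  rw [mul_assoc, S.s_mul_self, mul_one]

theorem lUp_s_mul (j : ι) (w : W) : S.LUp j (S.s j * w) ↔ ¬ S.LUp j w := by
  rw [LUp, mul_inv_rev, S.s_inv, S.up_mul_s, LUp]

theorem len_s_mul (j : ι) (w : W) : S.len (S.s j * w) = S.len (w⁻¹ * S.s j) := by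
  rw [← S.len_inv, mul_inv_rev, S.s_inv]

theorem lUp_iff_len {j : ι} (hj : j ∈ S.simple) (w : W) :
    S.LUp j w ↔ S.len w < S.len (S.s j * w) := by
  rw [LUp, S.up_iff_len j hj, len_s_mul, S.len_inv]

theorem len_s_mul_lt {j : ι} (hj : j ∈ S.simple) {w : W} (h : ¬ S.LUp j w) :
    S.len (S.s j * w) < S.len w := by
  rw [← S.lUp_s_mul, S.lUp_iff_len hj, s_mul_s_mul] at h
  exact h

theorem len_mul_s_lt {j : ι} (hj : j ∈ S.simple) {w : W} (h : ¬ S.Up j w) :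
    S.len (w * S.s j) < S.len w := by
  rw [← S.up_mul_s, S.up_iff_len j hj, mul_s_mul_s] at h
  exact h

theorem exists_not_lUp {w : W} (h : w ≠ 1) : ∃ j ∈ S.simple, ¬ S.LUp j w :=
  S.exists_not_up w⁻¹ (inv_ne_one.mpr h)

theorem up_s_mul_iff {j : ι} (hj : j ∈ S.simple) {i : ι} {w : W} (h : S.s j * w ≠ w * S.s i) :
    S.Up i (S.s j * w) ↔ S.Up i w := by
  constructor
  · intro h1
    by_contra h2
    have := S.fold j hj i (S.s j * w) h1 (by rwa [s_mul_s_mul])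
    rw [s_mul_s_mul] at this
    exact h (by rw [eq_comm, this, mul_s_mul_s, ← this])
  · intro h1
    by_contra h2
    exact h (S.fold j hj i w h1 h2)

theorem lUp_mul_s_iff {i j : ι} (hi : i ∈ S.simple) {w : W}
    (h : S.s j * w ≠ w * S.s i) : S.LUp j (w * S.s i) ↔ S.LUp j w := by
  rw [LUp, mul_inv_rev, S.s_inv, LUp]
  refine S.up_s_mul_iff hi fun h' => h ?_
  have := congrArg (fun x => x⁻¹) h'
  simp only [mul_inv_rev, S.s_inv, inv_inv] at this
  exact this.symm

/-- Left and right projections commute. By the folding condition they act independently, unless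
`s j * w = w * s i`, where both send the pair `w`, `w * s i` to its longer element. -/
theorem move_lmove {i j : ι} (hi : i ∈ S.simple) (hj : j ∈ S.simple) (w : W) :
    S.move i (S.lmove j w) = S.lmove j (S.move i w) := by
  by_cases h : S.s j * w = w * S.s i
  · have h1 : S.LUp j w ↔ S.Up i w := by rw [S.lUp_iff_len hj, S.up_iff_len i hi, h]
    by_cases hw : S.Up i w
    · have h2 : ¬ S.Up i (w * S.s i) := by rw [S.up_mul_s]; exact not_not.mpr hw
      have h3 : ¬ S.LUp j (w * S.s i) := by
        rw [← h, S.lUp_s_mul]; exact not_not.mpr (h1.mpr hw)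
      simp [move, lmove, h1, hw, h, h2, h3]
    · simp [move, lmove, h1, hw]
  · have h1 := S.up_s_mul_iff hj h
    have h2 := S.lUp_mul_s_iff hi h
    by_cases hw : S.Up i w <;> by_cases hw' : S.LUp j w <;>
      simp [move, lmove, hw, hw', h1, h2, mul_assoc]

theorem lmove_s_mul (j : ι) (w : W) : S.lmove j (S.s j * w) = S.lmove j w := by
  by_cases h : S.LUp j w
  · simp [lmove, S.lUp_s_mul, h]
  · simp [lmove, S.lUp_s_mul, h, s_mul_s_mul]

@[simp] theorem op_single (i : ι) (w : W) (c : ℂ) :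
    S.op i (Finsupp.single w c) = Finsupp.single (S.move i w) c := by
  simp [op, Finsupp.lmapDomain_apply, Finsupp.mapDomain_single]

@[simp] theorem lop_single (i : ι) (w : W) (c : ℂ) :
    S.lop i (Finsupp.single w c) = Finsupp.single (S.lmove i w) c := by
  simp [lop, Finsupp.lmapDomain_apply, Finsupp.mapDomain_single]

@[simp] theorem rightMul_single (v w : W) (c : ℂ) :
    rightMul v (Finsupp.single w c) = Finsupp.single (w * v) c := by
  simp [rightMul, Finsupp.lmapDomain_apply, Finsupp.mapDomain_single]

/-! ### Transitivity of the projections -/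

/-- `b` is obtained from `a` by a non-trivial application of some `π_i`. -/
def Step (a b : W) : Prop := ∃ i, S.Up i a ∧ b = a * S.s i

theorem eq_univ_of_mul_simple_mem {T : Set W} (hT : T.Nonempty)
    (h : ∀ w ∈ T, ∀ i, w * S.s i ∈ T) (v : W) : v ∈ T := by
  obtain ⟨w, hw⟩ := hT
  have key : ∀ u ∈ Subgroup.closure (S.s '' S.simple), ∀ w ∈ T, w * u ∈ T := by
    intro u hu
    induction hu using Subgroup.closure_induction'' with
    | mem u hu => obtain ⟨i, -, rfl⟩ := hu; exact fun w hw => h w hw i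
    | inv_mem u hu => obtain ⟨i, -, rfl⟩ := hu; rw [S.s_inv]; exact fun w hw => h w hw i
    | one => intro w hw; simpa using hw
    | mul a b _ _ ha hb => intro w hw; rw [← mul_assoc]; exact hb _ (ha _ hw)
  have := key (w⁻¹ * v) (by rw [S.closure_simple]; trivial) w hw
  rwa [mul_inv_cancel_left] at this

section Finite

variable [Finite W]

/-- A nonempty set closed under all projections is everything: the weights form a circulation that
is positive along the moves, so nothing can flow out of the set, and hence nothing can flow in. -/
theorem mem_of_closed_under_up {T : Set W} (hT : T.Nonempty)
    (h : ∀ w ∈ T, ∀ i, S.Up i w → w * S.s i ∈ T) (v : W) : v ∈ T := by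
  classical
  have := Fintype.ofFinite W
  refine S.eq_univ_of_mul_simple_mem hT ?_ v
  have h0 : ∑ i, ∑ w ∈ Finset.univ.filter (· ∈ T), S.weight w i = 0 := by
    rw [Finset.sum_comm]
    exact Finset.sum_eq_zero fun w _ => S.weight_sum w
  -- the weights along an edge inside `T` cancel
  have h1 : ∀ i, ∑ w ∈ Finset.univ.filter (fun w => w ∈ T ∧ w * S.s i ∈ T), S.weight w i = 0 := by
    intro i
    refine Finset.sum_involution (fun w _ => w * S.s i) ?_ ?_ ?_ ?_
    · intro w _; rw [S.weight_mul_s]; ring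
    · intro w _ _ hw
      have := S.up_mul_s i w
      rw [hw] at this
      tauto
    · intro w hw
      simp only [Finset.mem_filter, Finset.mem_univ, true_and, S.mul_s_mul_s] at hw ⊢
      exact hw.symm
    · intro w _; exact S.mul_s_mul_s i w
  -- an edge that leaves `T` cannot be a move, so it has negative weight
  have hle : ∀ i, ∀ w ∈ T, w * S.s i ∉ T → S.weight w i < 0 := by
    intro i w hw hn
    have hup : ¬ S.Up i w := fun hu => hn (h w hw i hu)
    rw [← S.up_mul_s, S.up_iff_weight, S.weight_mul_s] at hup
    linarith
  intro w hw i
  by_contra hn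
  have h2 : ∀ i, ∑ w ∈ Finset.univ.filter (· ∈ T), S.weight w i =
      ∑ w ∈ Finset.univ.filter (fun w => w ∈ T ∧ w * S.s i ∉ T), S.weight w i := by
    intro i
    rw [← Finset.sum_filter_add_sum_filter_not (Finset.univ.filter (· ∈ T))
      (fun w => w * S.s i ∈ T), Finset.filter_filter, Finset.filter_filter, h1, zero_add]
  have h3 : ∀ i, ∑ w ∈ Finset.univ.filter (· ∈ T), S.weight w i ≤ 0 := by
    intro i
    rw [h2]
    refine Finset.sum_nonpos fun w hw => ?_
    simp only [Finset.mem_filter, Finset.mem_univ, true_and] at hw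
    exact (hle i w hw.1 hw.2).le
  have h4 : ∑ w ∈ Finset.univ.filter (· ∈ T), S.weight w i < 0 := by
    rw [h2]
    refine Finset.sum_neg (fun w hw => ?_) ⟨w, by simp [hw, hn]⟩
    simp only [Finset.mem_filter, Finset.mem_univ, true_and] at hw
    exact hle i w hw.1 hw.2
  exact absurd h0 (Finset.sum_neg' (fun i _ => h3 i) ⟨i, Finset.mem_univ i, h4⟩).ne

theorem step_transitive (v w : W) : Relation.ReflTransGen S.Step v w :=
  S.mem_of_closed_under_up (T := {w | Relation.ReflTransGen S.Step v w}) ⟨v, .refl⟩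
    (fun _ ha i hi => Relation.ReflTransGen.tail ha ⟨i, hi, rfl⟩) w

end Finite

/-! ### Antisymmetrizations and indicator functions of cosets -/

/-- The sign character, as `(-1)` to the length. -/
def sign (w : W) : ℂ := (-1) ^ S.len w

theorem sign_mul_s {i : ι} (hi : i ∈ S.simple) (w : W) : S.sign (w * S.s i) = - S.sign w := by
  have key : ∀ v, S.Up i v → S.sign (v * S.s i) = - S.sign v := by
    intro v hv
    have h1 := (S.up_iff_len i hi v).mp hv
    have h2 := S.len_mul_le i hi v
    rw [sign, show S.len (v * S.s i) = S.len v + 1 by omega, pow_succ, sign]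
    ring
  by_cases h : S.Up i w
  · exact key w h
  · have := key (w * S.s i) (by rwa [S.up_mul_s])
    rw [S.mul_s_mul_s] at this
    rw [this, neg_neg]

theorem sign_inv (w : W) : S.sign w⁻¹ = S.sign w := by rw [sign, S.len_inv, sign]

theorem sign_s_mul {i : ι} (hi : i ∈ S.simple) (w : W) : S.sign (S.s i * w) = - S.sign w := by
  rw [← S.sign_inv, mul_inv_rev, S.s_inv, S.sign_mul_s hi, S.sign_inv]

theorem sign_ne_zero (w : W) : S.sign w ≠ 0 := pow_ne_zero _ (by norm_num)

theorem s_mem_parabolic {I : Set ι} {i : ι} (hi : i ∈ I) : S.s i ∈ S.parabolic I :=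
  Subgroup.subset_closure ⟨i, hi, rfl⟩

theorem parabolic_mono {I J : Set ι} (h : I ⊆ J) : S.parabolic I ≤ S.parabolic J :=
  Subgroup.closure_mono (Set.image_mono h)

theorem lUp_of_mem_parabolic {I : Set ι} (hI : I ⊆ S.simple) {u : W} (hu : u ∈ S.parabolic I)
    {i : ι} (hi : i ∈ S.simple) (hiI : i ∉ I) : S.LUp i u :=
  S.up_inv_of_mem_parabolic I hI u hu i hi hiI

theorem lUp_mul_iff {I : Set ι} (hI : I ⊆ S.simple) {x : W} (hx : ∀ i ∈ I, ¬ S.LUp i x)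
    {u : W} (hu : u ∈ S.parabolic I) {i : ι} (hi : i ∈ I) : S.LUp i (u * x) ↔ ¬ S.LUp i u :=
  S.up_inv_mul_iff I hI x hx u hu i hi

/-- If all `i ∈ I` are left descents of `x`, then `x` is the longest element of `W_I x`. -/
theorem len_mul_lt {I : Set ι} (hI : I ⊆ S.simple) {x : W} (hx : ∀ i ∈ I, ¬ S.LUp i x)
    {u : W} (hu : u ∈ S.parabolic I) (hu1 : u ≠ 1) : S.len (u * x) < S.len x := by
  induction hk : S.len u using Nat.strong_induction_on generalizing u with
  | _ k ih =>
    obtain ⟨i, hi, hiu⟩ := S.exists_not_lUp hu1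
    have hiI : i ∈ I := by
      by_contra h
      exact hiu (S.lUp_of_mem_parabolic hI hu hi h)
    have h1 : S.len (u * x) < S.len (S.s i * u * x) := by
      rw [mul_assoc]
      exact (S.lUp_iff_len hi _).mp ((S.lUp_mul_iff hI hx hu hiI).mpr hiu)
    by_cases h2 : S.s i * u = 1
    · rwa [h2, one_mul] at h1
    · exact h1.trans (ih _ (hk ▸ S.len_s_mul_lt hi hiu)
        (mul_mem (S.s_mem_parabolic hiI) hu) h2 rfl)

theorem exists_longest [Finite W] : ∃ w : W, ∀ i ∈ S.simple, ¬ S.LUp i w := by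
  obtain ⟨w, hw⟩ := Finite.exists_max S.len
  exact ⟨w, fun i hi h => absurd (hw (S.s i * w)) (not_le.mpr ((S.lUp_iff_len hi w).mp h))⟩

/-- Left multiplication by `s i` as a permutation of `W_I`. -/
def sEquiv {I : Set ι} {i : ι} (hi : i ∈ I) : S.parabolic I ≃ S.parabolic I :=
  Equiv.mulLeft ⟨S.s i, S.s_mem_parabolic hi⟩

theorem sEquiv_coe {I : Set ι} {i : ι} (hi : i ∈ I) (u : S.parabolic I) :
    ((S.sEquiv hi u : S.parabolic I) : W) = S.s i * u := rfl

/-- If `w s_i ∉ W_I w`, then `π_i` moves either all of `W_I w` or nothing. -/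
theorem up_mul_iff {I : Set ι} (hI : I ⊆ S.simple) {i : ι} {w : W}
    (h : ∀ u ∈ S.parabolic I, w * S.s i ≠ u * w) {u : W} (hu : u ∈ S.parabolic I) :
    S.Up i (u * w) ↔ S.Up i w := by
  have key : ∀ j ∈ I, ∀ v ∈ S.parabolic I, S.Up i (S.s j * (v * w)) ↔ S.Up i (v * w) := by
    intro j hj v hv
    refine S.up_s_mul_iff (hI hj) fun h' => h (v⁻¹ * S.s j * v)
      (mul_mem (mul_mem (inv_mem hv) (S.s_mem_parabolic hj)) hv) ?_
    rw [mul_assoc v⁻¹, mul_assoc v⁻¹, mul_assoc, h']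
    group
  have key2 : ∀ v ∈ S.parabolic I, S.Up i (u * (v * w)) ↔ S.Up i (v * w) := by
    unfold parabolic at hu
    induction hu using Subgroup.closure_induction'' with
    | mem u hu => obtain ⟨j, hj, rfl⟩ := hu; exact key j hj
    | inv_mem u hu => obtain ⟨j, hj, rfl⟩ := hu; rw [S.s_inv]; exact key j hj
    | one => simp
    | mul a b _ hb' ha hb =>
      intro v hv
      rw [mul_assoc, ← mul_assoc b, ha _ (mul_mem hb' hv), mul_assoc b, hb v hv]
  simpa using key2 1 (one_mem _)

open Classical in
/-- The indicator function of the coset `W_J w`, as a linear functional. -/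
noncomputable def indicator (J : Set ι) (w : W) : (W →₀ ℂ) →ₗ[ℂ] ℂ :=
  Finsupp.linearCombination ℂ fun x => if x * w⁻¹ ∈ S.parabolic J then (1 : ℂ) else 0

open Classical in
theorem indicator_single (J : Set ι) (w x : W) :
    S.indicator J w (Finsupp.single x 1) = if x * w⁻¹ ∈ S.parabolic J then (1 : ℂ) else 0 := by
  simp [indicator]

/-- Along an edge `w → w s_i` of the graph of moves, the indicator function of `W_J w` is obtained
from that of `W_J w s_i`, as the preimage under `π_i` of the latter coset is the union of both. -/
theorem indicator_comp_op {J : Set ι} (hJ : J ⊆ S.simple) {i : ι} {w : W} (hw : S.Up i w) :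
    S.indicator J (w * S.s i) ∘ₗ S.op i = S.indicator J w + S.indicator J (w * S.s i) ∨
      S.indicator J (w * S.s i) = S.indicator J w := by
  classical
  by_cases h : ∃ u ∈ S.parabolic J, w * S.s i = u * w
  · obtain ⟨u, hu, h⟩ := h
    right
    ext x
    simp only [LinearMap.comp_apply, Finsupp.lsingle_apply, indicator_single, h, mul_inv_rev,
      ← mul_assoc]
    simp only [Subgroup.mul_mem_cancel_right _ (inv_mem hu)]
  · push Not at h
    left
    have h1 : ∀ x, x * w⁻¹ ∈ S.parabolic J → S.Up i x := by
      intro x hx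
      have := (S.up_mul_iff hJ h hx).mpr hw
      rwa [inv_mul_cancel_right] at this
    have h2 : ∀ x, x * (w * S.s i)⁻¹ ∈ S.parabolic J → ¬ S.Up i x := by
      intro x hx
      have h3 := h1 (x * S.s i) (by
        rwa [mul_inv_rev, S.s_inv, ← mul_assoc] at hx)
      rwa [S.up_mul_s] at h3
    ext x
    simp only [LinearMap.comp_apply, Finsupp.lsingle_apply, LinearMap.add_apply, op_single,
      indicator_single]
    by_cases hx : S.Up i x
    · have h3 : ¬ x * (w * S.s i)⁻¹ ∈ S.parabolic J := fun h' => h2 x h' hx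
      rw [move, if_pos hx, if_neg h3, add_zero]
      simp [mul_assoc, S.s_inv, S.s_mul_s_mul]
    · have h3 : ¬ x * w⁻¹ ∈ S.parabolic J := fun h' => hx (h1 x h')
      rw [move, if_neg hx, if_neg h3, zero_add]

theorem indicator_comp_rightMul (J : Set ι) (w : W) :
    S.indicator J 1 ∘ₗ rightMul w⁻¹ = S.indicator J w := by
  ext x
  simp only [LinearMap.comp_apply, Finsupp.lsingle_apply, rightMul_single, indicator_single]
  rw [inv_one, mul_one]

section Finite

variable [Finite W]

noncomputable instance (I : Set ι) : Fintype (S.parabolic I) := Fintype.ofFinite _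

/-- The left antisymmetrization `∑_{u ∈ W_I} sign(u) u w`. -/
noncomputable def antisym (I : Set ι) (w : W) : W →₀ ℂ :=
  ∑ u : S.parabolic I, Finsupp.single ((u : W) * w) (S.sign u)

theorem antisym_s_mul {I : Set ι} (hI : I ⊆ S.simple) {i : ι} (hi : i ∈ I) (w : W) :
    S.antisym I (S.s i * w) = - S.antisym I w := by
  rw [antisym, antisym, ← Finset.sum_neg_distrib]
  refine Fintype.sum_equiv (Equiv.mulRight ⟨S.s i, S.s_mem_parabolic hi⟩) _ _ fun u => ?_
  simp [S.sign_mul_s (hI hi), mul_assoc]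

theorem antisym_mul {I : Set ι} (hI : I ⊆ S.simple) {u : W} (hu : u ∈ S.parabolic I) (w : W) :
    ∃ c : ℂ, S.antisym I (u * w) = c • S.antisym I w := by
  unfold parabolic at hu
  induction hu using Subgroup.closure_induction'' generalizing w with
  | mem u hu =>
    obtain ⟨i, hi, rfl⟩ := hu
    exact ⟨-1, by rw [S.antisym_s_mul hI hi, neg_one_smul]⟩
  | inv_mem u hu =>
    obtain ⟨i, hi, rfl⟩ := hu
    exact ⟨-1, by rw [S.s_inv, S.antisym_s_mul hI hi, neg_one_smul]⟩
  | one => exact ⟨1, by simp⟩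
  | mul a b _ _ ha hb =>
    obtain ⟨c, hc⟩ := ha (b * w)
    obtain ⟨c', hc'⟩ := hb w
    exact ⟨c * c', by rw [mul_assoc, hc, hc', smul_smul]⟩

/-- Along an edge `w → w s_i` of the graph of moves, the antisymmetrization of `w s_i` lies in the
orbit of that of `w`. -/
theorem op_antisym {I : Set ι} (hI : I ⊆ S.simple) {i : ι} {w : W} (hw : S.Up i w) :
    S.op i (S.antisym I w) = S.antisym I (w * S.s i) ∨
      ∃ c : ℂ, S.antisym I (w * S.s i) = c • S.antisym I w := by
  by_cases h : ∃ u ∈ S.parabolic I, w * S.s i = u * w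
  · obtain ⟨u, hu, h⟩ := h
    right
    rw [h]
    exact S.antisym_mul hI hu w
  · push Not at h
    left
    rw [antisym, antisym, map_sum]
    refine Finset.sum_congr rfl fun u _ => ?_
    rw [op_single, move, if_pos ((S.up_mul_iff hI h u.2).mpr hw), mul_assoc]

theorem rightMul_antisym (I : Set ι) (v w : W) :
    rightMul v (S.antisym I w) = S.antisym I (w * v) := by
  simp [antisym, map_sum, mul_assoc]

end Finite

/-! ### Operators preserving left antisymmetries -/

/-- The span of the differences `x - s_j x`: the vectors that are antisymmetric under left
multiplication by `s_j`. -/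
noncomputable def antisymSpace (j : ι) : Submodule ℂ (W →₀ ℂ) :=
  Submodule.span ℂ (Set.range fun x => Finsupp.single x (1 : ℂ) - Finsupp.single (S.s j * x) 1)

/-- The algebra of operators that preserve left antisymmetry under each simple reflection. -/
noncomputable def typePreserving : Subalgebra ℂ (Module.End ℂ (W →₀ ℂ)) where
  carrier := {T | ∀ j ∈ S.simple, ∀ v ∈ S.antisymSpace j, T v ∈ S.antisymSpace j}
  mul_mem' ha hb j hj v hv := ha j hj _ (hb j hj v hv)
  one_mem' _ _ _ hv := hv
  add_mem' ha hb j hj v hv := add_mem (ha j hj v hv) (hb j hj v hv)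
  zero_mem' _ _ _ _ := zero_mem _
  algebraMap_mem' c j hj v hv := by
    rw [Module.algebraMap_end_apply]
    exact Submodule.smul_mem _ _ hv

/-- It is enough to test the spanning vectors `x - s_j x`. -/
theorem mem_typePreserving_of_single {T : Module.End ℂ (W →₀ ℂ)}
    (h : ∀ j ∈ S.simple, ∀ x,
      T (Finsupp.single x 1) - T (Finsupp.single (S.s j * x) 1) ∈ S.antisymSpace j) :
    T ∈ S.typePreserving := by
  intro j hj v hv
  have : S.antisymSpace j ≤ (S.antisymSpace j).comap T := by
    refine Submodule.span_le.mpr ?_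
    rintro _ ⟨x, rfl⟩
    rw [SetLike.mem_coe, Submodule.mem_comap, map_sub]
    exact h j hj x
  exact this hv

theorem op_mem_typePreserving (i : ι) : S.op i ∈ S.typePreserving := by
  refine S.mem_typePreserving_of_single fun j hj x => ?_
  rw [op_single, op_single]
  by_cases h : S.s j * x = x * S.s i
  · have : S.move i (S.s j * x) = S.move i x := by
      by_cases hx : S.Up i x <;> simp [move, h, S.up_mul_s, hx, S.mul_s_mul_s]
    rw [this, sub_self]
    exact zero_mem _
  · have : S.move i (S.s j * x) = S.s j * S.move i x := by
      by_cases hx : S.Up i x <;> simp [move, S.up_s_mul_iff hj h, hx, mul_assoc]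
    rw [this]
    exact Submodule.subset_span ⟨_, rfl⟩

theorem rightMul_mem_typePreserving (v : W) : rightMul v ∈ S.typePreserving := by
  refine S.mem_typePreserving_of_single fun j hj x => ?_
  rw [rightMul_single, rightMul_single, mul_assoc]
  exact Submodule.subset_span ⟨_, rfl⟩

/-- The set of left descents of `w`. -/
def leftDescents (w : W) : Set ι := {j ∈ S.simple | ¬ S.LUp j w}

theorem leftDescents_subset (w : W) : S.leftDescents w ⊆ S.simple := fun _ h => h.1

/-! ### Rank one blocks in the `0`-Hecke algebra -/

/-- The `0`-Hecke algebra, generated by the projections of the simple reflections. -/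
noncomputable def zeroHecke : Subalgebra ℂ (Module.End ℂ (W →₀ ℂ)) :=
  Algebra.adjoin ℂ (S.op '' S.simple)

theorem lop_comm {a : Module.End ℂ (W →₀ ℂ)} (ha : a ∈ S.zeroHecke) {j : ι} (hj : j ∈ S.simple)
    (v : W →₀ ℂ) : a (S.lop j v) = S.lop j (a v) := by
  have h : S.zeroHecke ≤ Subalgebra.centralizer ℂ {S.lop j} := by
    refine Algebra.adjoin_le ?_
    rintro _ ⟨i, hi, rfl⟩
    rw [SetLike.mem_coe, Subalgebra.mem_centralizer_iff]
    rintro _ rfl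
    ext w : 1
    simp [LinearMap.ext_iff, S.move_lmove hi hj]
  have := (Subalgebra.mem_centralizer_iff ℂ).mp (h ha) _ rfl
  exact (LinearMap.congr_fun this v).symm

/-- Every element of `W` is reached from `1` by simple projections. -/
theorem exists_zeroHecke_single (w : W) :
    ∃ a ∈ S.zeroHecke, a (Finsupp.single 1 1) = Finsupp.single w 1 := by
  induction hk : S.len w using Nat.strong_induction_on generalizing w with
  | _ k ih =>
    by_cases hw : w = 1
    · exact ⟨1, one_mem _, by rw [hw]; rfl⟩
    · obtain ⟨i, hi, hiw⟩ := S.exists_not_up w hw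
      obtain ⟨a, ha, h⟩ := ih _ (hk ▸ S.len_mul_s_lt hi hiw) _ rfl
      refine ⟨S.op i * a, mul_mem (Algebra.subset_adjoin ⟨i, hi, rfl⟩) ha, ?_⟩
      rw [Module.End.mul_apply, h, op_single, move, if_pos ((S.up_mul_s i w).mpr hiw),
        S.mul_s_mul_s]

theorem exists_zeroHecke (v : W →₀ ℂ) : ∃ a ∈ S.zeroHecke, a (Finsupp.single 1 1) = v := by
  induction v using Finsupp.induction_linear with
  | zero => exact ⟨0, zero_mem _, rfl⟩
  | add f g hf hg =>
    obtain ⟨a, ha, h⟩ := hf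
    obtain ⟨b, hb, h'⟩ := hg
    exact ⟨a + b, add_mem ha hb, by rw [LinearMap.add_apply, h, h']⟩
  | single w c =>
    obtain ⟨a, ha, h⟩ := S.exists_zeroHecke_single w
    exact ⟨c • a, Subalgebra.smul_mem _ ha _, by rw [LinearMap.smul_apply, h]; simp⟩

section Finite

variable [Finite W]

theorem lop_antisym_of_mem {I : Set ι} (hI : I ⊆ S.simple) {i : ι} (hi : i ∈ I) (w : W) :
    S.lop i (S.antisym I w) = 0 := by
  have h : S.lop i (S.antisym I w) = - S.lop i (S.antisym I w) := by
    conv_lhs => rw [antisym, map_sum]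
    conv_rhs => rw [antisym, map_sum, ← Finset.sum_neg_distrib]
    refine Fintype.sum_equiv (S.sEquiv hi) _ _ fun u => ?_
    rw [S.sEquiv_coe, lop_single, lop_single, mul_assoc, S.lmove_s_mul, S.sign_s_mul (hI hi),
      Finsupp.single_neg, neg_neg]
  exact self_eq_neg.mp h

theorem lop_antisym_of_notMem {I : Set ι} (hI : I ⊆ S.simple) {i : ι} (hi : i ∈ S.simple)
    (hiI : i ∉ I) {x : W} (hx : ∀ i ∈ S.simple, ¬ S.LUp i x) :
    S.lop i (S.antisym I x) = S.antisym I x := by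
  rw [antisym, map_sum]
  refine Finset.sum_congr rfl fun u _ => ?_
  rw [lop_single, lmove, if_neg]
  rw [S.lUp_mul_iff (Set.Subset.refl _) hx (S.parabolic_mono hI u.2) hi, not_not]
  exact S.lUp_of_mem_parabolic hI u.2 hi hiI

/-- For `x` the longest element, the `0`-Hecke algebra contains the operator that sends the elements
of `W_J`, with `J` the complement of `I`, to the antisymmetrization of `x` under `W_I`, and the
other elements of `W` to zero. It is the element with the right value at `1`: this value is fixed
by the left projections of indices in `J` and killed by those of indices in `I`, and all of `W` is
reached from `1` by left projections. -/
theorem smulRight_indicator_mem_zeroHecke {I : Set ι} (hI : I ⊆ S.simple) {x : W}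
    (hx : ∀ i ∈ S.simple, ¬ S.LUp i x) :
    (S.indicator (S.simple \ I) 1).smulRight (S.antisym I x) ∈ S.zeroHecke := by
  classical
  obtain ⟨f, hf, hf1⟩ := S.exists_zeroHecke (S.antisym I x)
  have key : ∀ y, f (Finsupp.single y 1) =
      if y ∈ S.parabolic (S.simple \ I) then S.antisym I x else 0 := by
    intro y
    induction hk : S.len y using Nat.strong_induction_on generalizing y with
    | _ k ih =>
      by_cases hy : y = 1
      · rw [hy, hf1, if_pos (one_mem _)]
      · obtain ⟨j, hj, hjy⟩ := S.exists_not_lUp hy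
        have h1 := ih _ (hk ▸ S.len_s_mul_lt hj hjy) _ rfl
        have h2 : Finsupp.single y (1 : ℂ) = S.lop j (Finsupp.single (S.s j * y) 1) := by
          rw [lop_single, lmove, if_pos ((S.lUp_s_mul j y).mpr hjy), s_mul_s_mul]
        rw [h2, S.lop_comm hf hj, h1]
        by_cases hjI : j ∈ I
        · rw [if_neg (c := y ∈ _)]
          · split_ifs
            · exact S.lop_antisym_of_mem hI hjI x
            · exact map_zero _
          · exact fun h => hjy (S.lUp_of_mem_parabolic Set.sdiff_subset h hj (fun h' => h'.2 hjI))
        · simp only [Subgroup.mul_mem_cancel_left _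
            (S.s_mem_parabolic (show j ∈ S.simple \ I from ⟨hj, hjI⟩))]
          split_ifs
          · exact S.lop_antisym_of_notMem hI hj hjI hx
          · exact map_zero _
  convert hf
  ext y : 1
  ext1
  simp only [LinearMap.comp_apply, Finsupp.lsingle_apply, LinearMap.smulRight_apply,
    indicator_single, key, inv_one, mul_one]
  split_ifs <;> simp

/-! ### A basis adapted to left antisymmetries -/

/-- The antisymmetrization of `w` under the parabolic subgroup of its left descents. Its leading
term for the length is `w`. -/
noncomputable def adapted (w : W) : W →₀ ℂ := S.antisym (S.leftDescents w) w

theorem span_adapted : ⊤ ≤ Submodule.span ℂ (Set.range S.adapted) := by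
  classical
  have key : ∀ w, Finsupp.single w (1 : ℂ) ∈ Submodule.span ℂ (Set.range S.adapted) := by
    intro w
    induction hk : S.len w using Nat.strong_induction_on generalizing w with
    | _ k ih =>
      have h1 : S.adapted w ∈ Submodule.span ℂ (Set.range S.adapted) :=
        Submodule.subset_span ⟨w, rfl⟩
      rw [adapted, antisym, ← Finset.add_sum_erase _ _ (Finset.mem_univ 1)] at h1
      have h2 := (Submodule.add_mem_iff_left _ (Submodule.sum_mem _ fun u hu => ?_)).mp h1
      · rw [← Finsupp.smul_single_one,
          Submodule.smul_mem_iff _ (S.sign_ne_zero _)] at h2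
        simpa using h2
      · rw [← Finsupp.smul_single_one]
        refine Submodule.smul_mem _ _ (ih _ (hk ▸ ?_) _ rfl)
        exact S.len_mul_lt (S.leftDescents_subset w) (fun i hi => hi.2) u.2
          fun h => Finset.ne_of_mem_erase hu (Subtype.ext h)
  intro v _
  rw [← Finsupp.sum_single v]
  refine Submodule.sum_mem _ fun w _ => ?_
  rw [← Finsupp.smul_single_one]
  exact Submodule.smul_mem _ _ (key w)

/-- The adapted basis of `ℂ.W`: each space of left antisymmetries is spanned by a part of it. -/
noncomputable def adaptedBasis [Fintype W] : Module.Basis W ℂ (W →₀ ℂ) :=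
  basisOfTopLeSpanOfCardEqFinrank S.adapted S.span_adapted
    (Module.finrank_finsupp_self ℂ).symm

theorem adaptedBasis_apply [Fintype W] (w : W) : S.adaptedBasis w = S.adapted w := by
  rw [adaptedBasis, coe_basisOfTopLeSpanOfCardEqFinrank]

theorem two_smul_antisym {I : Set ι} (hI : I ⊆ S.simple) {j : ι} (hj : j ∈ I) (w : W) :
    (2 : ℂ) • S.antisym I w = ∑ u : S.parabolic I, S.sign u •
      (Finsupp.single ((u : W) * w) (1 : ℂ) - Finsupp.single (S.s j * (u * w)) 1) := by
  have h : S.antisym I w = ∑ u : S.parabolic I, S.sign u •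
      - Finsupp.single (S.s j * ((u : W) * w)) (1 : ℂ) := by
    refine Fintype.sum_equiv (S.sEquiv hj) _ _ fun u => ?_
    rw [S.sEquiv_coe, S.sign_s_mul (hI hj), mul_assoc, s_mul_s_mul, smul_neg, neg_smul, neg_neg,
      Finsupp.smul_single_one]
  rw [two_smul]
  nth_rw 2 [h]
  rw [antisym, ← Finset.sum_add_distrib]
  refine Finset.sum_congr rfl fun u _ => ?_
  rw [smul_sub, smul_neg, ← sub_eq_add_neg, Finsupp.smul_single_one, Finsupp.smul_single_one]

/-- The spaces of left antisymmetric vectors are spanned by parts of the adapted basis. By induction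
on the length of `x`: twice `S.adapted x` is the sum of twice `x - s_j x` and of differences
`± (y - s_j y)` with `y` and `s_j y` shorter than `x`. -/
theorem antisymSpace_le {j : ι} (hj : j ∈ S.simple) :
    S.antisymSpace j ≤ Submodule.span ℂ (S.adapted '' {w | j ∈ S.leftDescents w}) := by
  classical
  set M := Submodule.span ℂ (S.adapted '' {w | j ∈ S.leftDescents w}) with hM
  have key : ∀ x, ¬ S.LUp j x →
      Finsupp.single x (1 : ℂ) - Finsupp.single (S.s j * x) 1 ∈ M := by
    intro x
    induction hk : S.len x using Nat.strong_induction_on generalizing x with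
    | _ k ih =>
      intro hx
      have hjx : j ∈ S.leftDescents x := ⟨hj, hx⟩
      have hI := S.leftDescents_subset x
      have h1 : (2 : ℂ) • S.adapted x ∈ M :=
        Submodule.smul_mem _ _ (Submodule.subset_span ⟨x, hjx, rfl⟩)
      set t : S.parabolic (S.leftDescents x) → (W →₀ ℂ) := fun u => S.sign u •
        (Finsupp.single ((u : W) * x) (1 : ℂ) - Finsupp.single (S.s j * (u * x)) 1) with ht
      set sj : S.parabolic (S.leftDescents x) := ⟨S.s j, S.s_mem_parabolic hjx⟩ with hsj
      have hne : sj ≠ 1 := by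
        intro h
        have h' : S.s j = 1 := congrArg Subtype.val h
        have := S.lUp_s_mul j x
        rw [h', one_mul] at this
        tauto
      have hlen : ∀ u : S.parabolic (S.leftDescents x), u ≠ 1 → S.len (u * x) < k := by
        intro u hu
        rw [← hk]
        exact S.len_mul_lt hI (fun i hi => hi.2) u.2 fun h => hu (Subtype.ext h)
      rw [adapted, S.two_smul_antisym hI hjx, ← Finset.add_sum_erase _ t (Finset.mem_univ 1),
        ← Finset.add_sum_erase _ t (Finset.mem_erase.mpr ⟨hne, Finset.mem_univ sj⟩),
        ← add_assoc] at h1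
      have h2 := (Submodule.add_mem_iff_left _ (Submodule.sum_mem _ fun u hu => ?_)).mp h1
      · have h3 : t 1 + t sj = (2 * S.sign 1) •
            (Finsupp.single x (1 : ℂ) - Finsupp.single (S.s j * x) 1) := by
          have : S.sign (S.s j) = - S.sign 1 := by simpa using S.sign_s_mul hj 1
          simp only [ht, hsj, OneMemClass.coe_one, one_mul, this, s_mul_s_mul]
          module
        rw [h3, Submodule.smul_mem_iff _ (mul_ne_zero two_ne_zero (S.sign_ne_zero _))] at h2
        exact h2
      · have hu1 : u ≠ sj := Finset.ne_of_mem_erase hu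
        have hu2 : u ≠ 1 := Finset.ne_of_mem_erase (Finset.mem_of_mem_erase hu)
        refine Submodule.smul_mem _ _ ?_
        by_cases hju : S.LUp j (u * x)
        · have h4 := hlen (sj * u) (by
            intro h
            have hss : sj * sj = 1 := Subtype.ext (S.s_mul_self j)
            exact hu1 (mul_left_cancel (h.trans hss.symm)))
          have h5 := ih _ h4 (S.s j * (u * x)) (by simp [hsj, mul_assoc]) (by
            rw [S.lUp_s_mul]; exact not_not.mpr hju)
          rw [s_mul_s_mul] at h5
          rw [← neg_sub]
          exact neg_mem h5
        · exact ih _ (hlen u hu2) _ rfl hju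
  refine Submodule.span_le.mpr ?_
  rintro _ ⟨x, rfl⟩
  by_cases hx : S.LUp j x
  · have := key (S.s j * x) (by rw [S.lUp_s_mul]; exact not_not.mpr hx)
    rw [s_mul_s_mul] at this
    rw [SetLike.mem_coe]
    simpa using neg_mem this
  · exact key x hx

theorem coord_eq_zero_of_mem [Fintype W] {j : ι} (hj : j ∈ S.simple) {w : W}
    (hw : j ∉ S.leftDescents w) {v : W →₀ ℂ} (hv : v ∈ S.antisymSpace j) :
    S.adaptedBasis.coord w v = 0 := by
  classical
  have : Submodule.span ℂ (S.adapted '' {w | j ∈ S.leftDescents w}) ≤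
      LinearMap.ker (S.adaptedBasis.coord w) := by
    refine Submodule.span_le.mpr ?_
    rintro _ ⟨x, hx, rfl⟩
    rw [SetLike.mem_coe, LinearMap.mem_ker, ← adaptedBasis_apply, Module.Basis.coord_apply,
      Module.Basis.repr_self, Finsupp.single_apply, if_neg]
    rintro rfl
    exact hw hx
  exact this (S.antisymSpace_le hj hv)

/-- A functional that is constant on the cosets `W_J x` is a combination of their indicator
functions. -/
theorem smulRight_mem_of_indicator_mem (𝒜 : Subalgebra ℂ (Module.End ℂ (W →₀ ℂ)))
    {J : Set ι} {v : W →₀ ℂ} (h : ∀ w, (S.indicator J w).smulRight v ∈ 𝒜)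
    {ψ : (W →₀ ℂ) →ₗ[ℂ] ℂ}
    (hψ : ∀ j ∈ J, ∀ x, ψ (Finsupp.single (S.s j * x) 1) = ψ (Finsupp.single x 1)) :
    ψ.smulRight v ∈ 𝒜 := by
  classical
  have := Fintype.ofFinite W
  have hψ' : ∀ u ∈ S.parabolic J, ∀ x,
      ψ (Finsupp.single (u * x) 1) = ψ (Finsupp.single x 1) := by
    intro u hu
    unfold parabolic at hu
    induction hu using Subgroup.closure_induction'' with
    | mem u hu => obtain ⟨j, hj, rfl⟩ := hu; exact hψ j hj
    | inv_mem u hu => obtain ⟨j, hj, rfl⟩ := hu; rw [S.s_inv]; exact hψ j hj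
    | one => simp
    | mul a b _ _ ha hb => intro x; rw [mul_assoc, ha, hb]
  -- the order of `W_J`, by which the sum over all of `W` overcounts
  set c : ℂ := ∑ z : W, if z ∈ S.parabolic J then (1 : ℂ) else 0 with hc
  have hc0 : c ≠ 0 := by
    rw [hc, Finset.sum_boole, Nat.cast_ne_zero]
    exact (Finset.card_pos.mpr ⟨1, by simp [one_mem]⟩).ne'
  have h1 : c • ψ.smulRight v =
      ∑ y : W, ψ (Finsupp.single y 1) • (S.indicator J y).smulRight v := by
    ext x : 1
    ext1
    have h2 : ∑ y : W, ψ (Finsupp.single y 1) * S.indicator J y (Finsupp.single x 1) =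
        c * ψ (Finsupp.single x 1) := by
      rw [hc, Finset.sum_mul]
      refine Fintype.sum_equiv ((Equiv.inv W).trans (Equiv.mulLeft x)) _ _ fun y => ?_
      simp only [Equiv.trans_apply, Equiv.inv_apply, Equiv.coe_mulLeft, indicator_single]
      split_ifs with h'
      · have := hψ' _ h' y
        rw [inv_mul_cancel_right] at this
        rw [this, mul_comm]
      · ring
    simp only [LinearMap.comp_apply, Finsupp.lsingle_apply, LinearMap.smul_apply,
      LinearMap.smulRight_apply, LinearMap.sum_apply, smul_smul, ← Finset.sum_smul, h2]
  have h3 : c • ψ.smulRight v ∈ 𝒜 := by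
    rw [h1]
    exact Subalgebra.sum_mem _ fun y _ => Subalgebra.smul_mem _ (h y) _
  have := Subalgebra.smul_mem 𝒜 h3 c⁻¹
  rwa [smul_smul, inv_mul_cancel₀ hc0, one_smul] at this

/-- A subalgebra that contains the `0`-Hecke algebra and acts transitively on antisymmetrizations
and on indicator functions of cosets contains all operators preserving left antisymmetries. -/
theorem typePreserving_le (𝒜 : Subalgebra ℂ (Module.End ℂ (W →₀ ℂ)))
    (h0 : S.zeroHecke ≤ 𝒜)
    (h1 : ∀ I ⊆ S.simple, ∀ x w, ∃ c ∈ 𝒜, c (S.antisym I x) = S.antisym I w)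
    (h2 : ∀ J ⊆ S.simple, ∀ w, ∃ c ∈ 𝒜, S.indicator J 1 ∘ₗ c = S.indicator J w) :
    S.typePreserving ≤ 𝒜 := by
  intro T hT
  have := Fintype.ofFinite W
  obtain ⟨x, hx⟩ := S.exists_longest
  have key : ∀ I ⊆ S.simple, ∀ w w',
      (S.indicator (S.simple \ I) w).smulRight (S.antisym I w') ∈ 𝒜 := by
    intro I hI w w'
    obtain ⟨a, ha, ha'⟩ := h1 I hI x w'
    obtain ⟨b, hb, hb'⟩ := h2 (S.simple \ I) Set.sdiff_subset w
    have := mul_mem (mul_mem ha (h0 (S.smulRight_indicator_mem_zeroHecke hI hx))) hb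
    convert this
    refine LinearMap.ext fun y => ?_
    rw [← hb', ← ha']
    simp [Module.End.mul_apply]
  have hsum : T = ∑ w, (S.adaptedBasis.coord w ∘ₗ T).smulRight (S.adapted w) := by
    refine LinearMap.ext fun v => ?_
    simp only [LinearMap.sum_apply, LinearMap.smulRight_apply, LinearMap.comp_apply,
      ← adaptedBasis_apply, Module.Basis.coord_apply]
    exact (S.adaptedBasis.sum_repr (T v)).symm
  rw [hsum]
  refine Subalgebra.sum_mem _ fun w _ => ?_
  refine S.smulRight_mem_of_indicator_mem 𝒜 (fun y => key _ (S.leftDescents_subset w) y w) ?_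
  rintro j ⟨hj, hjw⟩ y
  rw [eq_comm, ← sub_eq_zero, ← map_sub]
  exact S.coord_eq_zero_of_mem hj hjw (hT j hj _ (Submodule.subset_span ⟨y, rfl⟩))

/-! ### Generators of the algebra of type preserving operators -/

theorem adjoin_op_eq : Algebra.adjoin ℂ (Set.range S.op) = S.typePreserving := by
  have hop : ∀ i, S.op i ∈ Algebra.adjoin ℂ (Set.range S.op) :=
    fun i => Algebra.subset_adjoin ⟨i, rfl⟩
  refine le_antisymm (Algebra.adjoin_le ?_) (S.typePreserving_le _ ?_ ?_ ?_)
  · rintro _ ⟨i, rfl⟩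
    exact S.op_mem_typePreserving i
  · exact Algebra.adjoin_mono (Set.image_subset_range _ _)
  · intro I hI x w
    induction S.step_transitive x w with
    | refl => exact ⟨1, one_mem _, rfl⟩
    | tail _ hbc ih =>
      obtain ⟨i, hi, rfl⟩ := hbc
      obtain ⟨a, ha, h⟩ := ih
      obtain h' | ⟨c, hc⟩ := S.op_antisym hI hi
      · exact ⟨S.op i * a, mul_mem (hop i) ha, by rw [Module.End.mul_apply, h, h']⟩
      · exact ⟨c • a, Subalgebra.smul_mem _ ha _, by rw [LinearMap.smul_apply, h, hc]⟩
  · intro J hJ w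
    induction S.step_transitive w 1 using Relation.ReflTransGen.head_induction_on with
    | refl => exact ⟨1, one_mem _, rfl⟩
    | head hbc _ ih =>
      obtain ⟨i, hi, rfl⟩ := hbc
      obtain ⟨a, ha, h⟩ := ih
      obtain h' | h' := S.indicator_comp_op hJ hi
      · refine ⟨a * S.op i + (-1 : ℂ) • a,
          add_mem (mul_mem ha (hop i)) (Subalgebra.smul_mem _ ha _), ?_⟩
        rw [LinearMap.comp_add, LinearMap.comp_smul, h, Module.End.mul_eq_comp,
          ← LinearMap.comp_assoc, h, h', neg_one_smul, add_neg_cancel_right]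
      · exact ⟨a, ha, by rw [h, h']⟩

theorem heckeGroup_eq :
    S.zeroHecke ⊔ Algebra.adjoin ℂ (Set.range (rightMul (W := W))) = S.typePreserving := by
  have hR : ∀ v : W, rightMul v ∈ S.zeroHecke ⊔ Algebra.adjoin ℂ (Set.range (rightMul (W := W))) :=
    fun v => (le_sup_right : _ ≤ S.zeroHecke ⊔ _) (Algebra.subset_adjoin ⟨v, rfl⟩)
  refine le_antisymm (sup_le (Algebra.adjoin_le ?_) (Algebra.adjoin_le ?_))
    (S.typePreserving_le _ le_sup_left ?_ ?_)
  · rintro _ ⟨i, -, rfl⟩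
    exact S.op_mem_typePreserving i
  · rintro _ ⟨v, rfl⟩
    exact S.rightMul_mem_typePreserving v
  · intro I _ x w
    exact ⟨rightMul (x⁻¹ * w), hR _, by rw [S.rightMul_antisym, mul_inv_cancel_left]⟩
  · intro J _ w
    exact ⟨rightMul w⁻¹, hR _, S.indicator_comp_rightMul J w⟩

end Finite

end ReflectionCombinatorics

/-! ### Tits' positivity argument -/

namespace CoxeterWord

section Word

variable {ι W : Type*} [Group W] (s : ι → W)

/-- The length of `w` with respect to the generators `s` (`0` if `w` is not a product of them). -/
noncomputable def length (w : W) : ℕ := sInf {k | ∃ l : List ι, l.length = k ∧ (l.map s).prod = w}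

theorem length_prod_le (l : List ι) : length s (l.map s).prod ≤ l.length :=
  Nat.sInf_le ⟨l, rfl, rfl⟩

variable {s} (hs : ∀ i, s i * s i = 1) (hgen : Subgroup.closure (Set.range s) = ⊤)

include hs hgen in
theorem exists_word (w : W) : ∃ l : List ι, (l.map s).prod = w := by
  have hw : w ∈ Subgroup.closure (Set.range s) := by rw [hgen]; trivial
  induction hw using Subgroup.closure_induction'' with
  | mem u hu => obtain ⟨i, rfl⟩ := hu; exact ⟨[i], by simp⟩
  | inv_mem u hu =>
    obtain ⟨i, rfl⟩ := hu; exact ⟨[i], by simp [inv_eq_of_mul_eq_one_left (hs i)]⟩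
  | one => exact ⟨[], rfl⟩
  | mul a b _ _ ha hb =>
    obtain ⟨l, rfl⟩ := ha
    obtain ⟨l', rfl⟩ := hb
    exact ⟨l ++ l', by simp⟩

include hs hgen in
theorem exists_reduced_word (w : W) :
    ∃ l : List ι, l.length = length s w ∧ (l.map s).prod = w := by
  obtain ⟨l, hl⟩ := exists_word hs hgen w
  exact Nat.sInf_mem (s := {k | ∃ l : List ι, l.length = k ∧ (l.map s).prod = w}) ⟨_, l, rfl, hl⟩

include hs hgen in
theorem length_mul_le (v w : W) : length s (v * w) ≤ length s v + length s w := by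
  obtain ⟨l, hl, rfl⟩ := exists_reduced_word hs hgen v
  obtain ⟨l', hl', rfl⟩ := exists_reduced_word hs hgen w
  rw [← hl, ← hl', ← List.prod_append, ← List.map_append, ← List.length_append]
  exact length_prod_le s _

theorem length_s_le (i : ι) : length s (s i) ≤ 1 := by
  simpa using length_prod_le s [i]

include hs hgen in
theorem length_inv (w : W) : length s w⁻¹ = length s w := by
  have key : ∀ w, length s w⁻¹ ≤ length s w := by
    intro w
    obtain ⟨l, hl, rfl⟩ := exists_reduced_word hs hgen w
    have : (l.map s).prod⁻¹ = (l.reverse.map s).prod := by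
      rw [List.prod_inv_reverse, List.map_map, List.map_reverse]
      congr 2
      exact List.map_congr_left fun i _ => inv_eq_of_mul_eq_one_left (hs i)
    rw [this, ← hl, ← List.length_reverse]
    exact length_prod_le s _
  exact le_antisymm (key w) (by simpa using key w⁻¹)

include hs hgen in
theorem exists_length_mul_lt {w : W} (hw : w ≠ 1) : ∃ i, length s (w * s i) < length s w := by
  obtain ⟨l, hl, rfl⟩ := exists_reduced_word hs hgen w
  rcases List.eq_nil_or_concat l with rfl | ⟨l', i, rfl⟩
  · exact absurd rfl hw
  · refine ⟨i, ?_⟩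
    rw [← hl]
    simp only [List.concat_eq_append, List.map_append, List.prod_append, List.map_cons,
      List.map_nil, List.prod_cons, List.prod_nil, mul_one, mul_assoc, hs, List.length_append,
      List.length_cons, List.length_nil]
    exact Nat.lt_succ_of_le (length_prod_le s _)

variable (s) in
/-- The alternating word `⋯ s_j s_i s_j` with `k` letters, ending with `s_j`. -/
def alt : ℕ → ι → ι → W
  | 0, _, _ => 1
  | k + 1, i, j => alt k j i * s j

/-- The recursion for `alt` that adds a letter on the left. -/
theorem alt_succ (k : ℕ) (i j : ι) :
    alt s (k + 1) i j = s (if Even k then j else i) * alt s k i j := by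
  induction k generalizing i j with
  | zero => simp [alt]
  | succ k ih =>
    rw [alt, ih, alt, mul_assoc]
    by_cases h : Even k <;> simp [h, Nat.even_add_one]

include hs hgen in
theorem length_alt_le (k : ℕ) (i j : ι) : length s (alt s k i j) ≤ k := by
  induction k generalizing i j with
  | zero => simpa [alt] using length_prod_le s []
  | succ k ih =>
    exact (length_mul_le hs hgen _ _).trans (add_le_add (ih j i) (length_s_le j))

include hs hgen in
theorem exists_alt_add (a m : ℕ) (i j : ι) :
    ∃ x, length s x ≤ a ∧ alt s (a + m) i j = x * alt s m i j := by
  induction a with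
  | zero => exact ⟨1, by simpa using length_prod_le s [], by simp⟩
  | succ a ih =>
    obtain ⟨x, hx, h⟩ := ih
    refine ⟨s (if Even (a + m) then j else i) * x, ?_, ?_⟩
    · have := length_mul_le hs hgen (s (if Even (a + m) then j else i)) x
      have := length_s_le (s := s) (if Even (a + m) then j else i)
      omega
    · rw [Nat.add_right_comm, alt_succ, h, mul_assoc]

theorem map_alt {ι G H : Type*} [Group G] [Group H] (f : G →* H) (s : ι → G) (k : ℕ) (i j : ι) :
    f (alt s k i j) = alt (fun i => f (s i)) k i j := by
  induction k generalizing i j with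
  | zero => exact map_one f
  | succ k ih => rw [alt, map_mul, ih, alt]

end Word

/-- The order of `s_i s_j` as a function of `a_{ij} a_{ji}`, meaningful for values from `0` to
`3`. -/
def order (t : ℤ) : ℕ := if t = 0 then 2 else if t = 1 then 3 else if t = 2 then 4 else 6

section Roots

variable {ι W E : Type*} [Group W] [AddCommGroup E] [Module ℝ E] {s : ι → W}
  (ρ : W →* Module.End ℝ E) (α : ι → E) (A : ι → ι → ℤ)

/-- In rank two, an alternating word that ends with `s_j` and is shorter than the braid relation
maps `α_i` to a nonnegative combination of `α_i` and `α_j`. -/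
theorem alt_apply_root (hρ : ∀ i k, ρ (s i) (α k) = α k - (A i k : ℝ) • α i)
    {i j : ι} (hi : A i i = 2) (hj : A j j = 2) (hij : A i j ≤ 0) (hji : A j i ≤ 0)
    (h3 : A i j * A j i ≤ 3) {k : ℕ}
    (hk : k < order (A i j * A j i)) :
    ∃ x y : ℝ, 0 ≤ x ∧ 0 ≤ y ∧ ρ (alt s k i j) (α i) = x • α i + y • α j := by
  set t := A i j * A j i with ht
  have ht0 : 0 ≤ t := mul_nonneg_of_nonpos_of_nonpos hij hji
  have htR : (A i j : ℝ) * A j i = t := by rw [ht]; push_cast; rfl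
  have hbR : (A j i : ℝ) ≤ 0 := by exact_mod_cast hji
  have e0 : ρ (alt s 0 i j) (α i) = (1 : ℝ) • α i + (0 : ℝ) • α j := by simp [alt]
  have ei : ∀ x y : ℝ, ρ (s i) (x • α i + y • α j) = (-x - y * A i j) • α i + y • α j := by
    intro x y
    rw [map_add, map_smul, map_smul, hρ, hρ, hi]
    push_cast
    module
  have ej : ∀ x y : ℝ, ρ (s j) (x • α i + y • α j) = x • α i + (-y - x * A j i) • α j := by
    intro x y
    rw [map_add, map_smul, map_smul, hρ, hρ, hj]
    push_cast
    module
  have e1 : ρ (alt s 1 i j) (α i) = (1 : ℝ) • α i + (-(A j i : ℝ)) • α j := by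
    rw [alt_succ, map_mul, Module.End.mul_apply, e0, if_pos (by decide), ej]
    congr 2; ring
  have e2 : ρ (alt s 2 i j) (α i) = (t - 1 : ℝ) • α i + (-(A j i : ℝ)) • α j := by
    rw [alt_succ, map_mul, Module.End.mul_apply, e1, if_neg (by decide), ei, ← htR]
    congr 2; ring
  have e3 : ρ (alt s 3 i j) (α i) = (t - 1 : ℝ) • α i + (-(A j i : ℝ) * (t - 2)) • α j := by
    rw [alt_succ, map_mul, Module.End.mul_apply, e2, if_pos (by decide), ej, ← htR]
    congr 2; ring
  have e4 : ρ (alt s 4 i j) (α i) =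
      (t ^ 2 - 3 * t + 1 : ℝ) • α i + (-(A j i : ℝ) * (t - 2)) • α j := by
    rw [alt_succ, map_mul, Module.End.mul_apply, e3, if_neg (by decide), ei, ← htR]
    congr 2; ring
  have e5 : ρ (alt s 5 i j) (α i) =
      (t ^ 2 - 3 * t + 1 : ℝ) • α i + (-(A j i : ℝ) * ((t - 1) * (t - 3))) • α j := by
    rw [alt_succ, map_mul, Module.End.mul_apply, e4, if_pos (by decide), ej, ← htR]
    congr 2; ring
  clear_value t
  have hcase : t = 0 ∨ t = 1 ∨ t = 2 ∨ t = 3 := by omega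
  rcases hcase with rfl | rfl | rfl | rfl
  · have : k < 2 := by simpa [order] using hk
    interval_cases k
    · exact ⟨_, _, by norm_num, by norm_num, e0⟩
    · exact ⟨_, _, by norm_num, by linarith, e1⟩
  · have : k < 3 := by simpa [order] using hk
    interval_cases k
    · exact ⟨_, _, by norm_num, by norm_num, e0⟩
    · exact ⟨_, _, by norm_num, by linarith, e1⟩
    · exact ⟨_, _, by norm_num, by linarith, e2⟩
  · have : k < 4 := by simpa [order] using hk
    interval_cases k
    · exact ⟨_, _, by norm_num, by norm_num, e0⟩
    · exact ⟨_, _, by norm_num, by linarith, e1⟩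
    · exact ⟨_, _, by norm_num, by linarith, e2⟩
    · exact ⟨_, _, by norm_num, by norm_num, e3⟩
  · have : k < 6 := by simpa [order] using hk
    interval_cases k
    · exact ⟨_, _, by norm_num, by norm_num, e0⟩
    · exact ⟨_, _, by norm_num, by linarith, e1⟩
    · exact ⟨_, _, by norm_num, by linarith, e2⟩
    · exact ⟨_, _, by norm_num, by norm_num; linarith, e3⟩
    · exact ⟨_, _, by norm_num, by norm_num; linarith, e4⟩
    · exact ⟨_, _, by norm_num, by norm_num, e5⟩

/-- If `w s_i` is not shorter than `w`, then `w α_i` lies in every convex cone `P` that contains the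
simple roots. -/
theorem apply_root_mem_of_length_le (hs : ∀ i, s i * s i = 1)
    (hgen : Subgroup.closure (Set.range s) = ⊤)
    (hρ : ∀ i k, ρ (s i) (α k) = α k - (A i k : ℝ) • α i)
    (hdiag : ∀ i, A i i = 2) (hnonpos : ∀ i j, i ≠ j → A i j ≤ 0)
    (h3 : ∀ i j, i ≠ j → A i j * A j i ≤ 3)
    (hbraid : ∀ i j, i ≠ j →
      alt s (order (A i j * A j i)) i j = alt s (order (A i j * A j i)) j i)
    {P : Set E} (hα : ∀ i, α i ∈ P)
    (hP : ∀ x ∈ P, ∀ y ∈ P, ∀ a b : ℝ, 0 ≤ a → 0 ≤ b → a • x + b • y ∈ P)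
    (w : W) (i : ι) (hw : length s w ≤ length s (w * s i)) : ρ w (α i) ∈ P := by
  classical
  induction hn : length s w using Nat.strong_induction_on generalizing w i with
  | _ n ih =>
  by_cases hw1 : w = 1
  · rw [hw1, map_one]
    exact hα i
  obtain ⟨j, hj⟩ := exists_length_mul_lt hs hgen hw1
  have hij : i ≠ j := by
    rintro rfl
    omega
  -- write `w = v * alt k i j` with additive lengths and `k` as large as possible
  let Q : ℕ → Prop := fun k => ∃ v, w = v * alt s k i j ∧ length s w = length s v + k
  have hQ1 : Q 1 := by
    refine ⟨w * s j, by simp [alt, mul_assoc, hs], ?_⟩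
    have := length_mul_le hs hgen (w * s j) (s j)
    rw [mul_assoc, hs, mul_one] at this
    have := length_s_le (s := s) j
    omega
  have hQle : ∀ k, Q k → k ≤ length s w := fun k ⟨v, _, h⟩ => by omega
  have hspec : Q (Nat.findGreatest Q (length s w)) := Nat.findGreatest_spec (hQle 1 hQ1) hQ1
  have hmax : ∀ k, Q k → k ≤ Nat.findGreatest Q (length s w) :=
    fun k hk => Nat.le_findGreatest (hQle k hk) hk
  set k := Nat.findGreatest Q (length s w) with hk
  clear_value k
  have hk1 := hmax 1 hQ1
  obtain ⟨v, hv, hlv⟩ := hspec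
  -- otherwise the braid relation gives `w` a reduced word ending with `s_i`
  have hkm : k < order (A i j * A j i) := by
    by_contra hge
    push Not at hge
    obtain ⟨a, ha⟩ := Nat.exists_eq_add_of_le' hge
    obtain ⟨m, hm⟩ : ∃ m, order (A i j * A j i) = m + 1 := by
      unfold order
      split_ifs <;> exact ⟨_, rfl⟩
    obtain ⟨x, hx, h⟩ := exists_alt_add hs hgen a (order (A i j * A j i)) i j
    have h1 : w * s i = v * x * alt s m i j := by
      rw [hv, ha, h, hbraid i j hij, hm, alt]
      simp only [mul_assoc, hs, mul_one]
    have h2 := length_mul_le hs hgen (v * x) (alt s m i j)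
    have h3 := length_mul_le hs hgen v x
    have h4 := length_alt_le hs hgen m i j
    rw [h1] at hw
    omega
  -- neither letter shortens `v` from the right: the one that prolongs the alternating word by
  -- maximality of `k`, the other one by additivity of the lengths
  have hd : length s v ≤ length s (v * s (if Even k then j else i)) := by
    by_contra hlt
    have : Q (k + 1) := by
      refine ⟨v * s (if Even k then j else i), ?_, ?_⟩
      · rw [alt_succ, mul_assoc, ← mul_assoc (s _) (s _), hs, one_mul, hv]
      · have h1 := length_mul_le hs hgen (v * s (if Even k then j else i)) (alt s (k + 1) i j)
        rw [alt_succ, mul_assoc, ← mul_assoc (s _) (s _), hs, one_mul, ← hv, ← alt_succ] at h1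
        have := length_alt_le hs hgen (k + 1) i j
        omega
    have := hmax _ this
    omega
  have hc : length s v ≤ length s (v * s (if Even k then i else j)) := by
    by_contra hlt
    obtain ⟨k', rfl⟩ := Nat.exists_eq_add_of_le' hk1
    have h1 := length_mul_le hs hgen (v * s (if Even (k' + 1) then i else j)) (alt s k' i j)
    have h2 : v * s (if Even (k' + 1) then i else j) * alt s k' i j = w := by
      rw [hv, alt_succ, mul_assoc]
      by_cases h : Even k' <;> simp [h, Nat.even_add_one]
    rw [h2] at h1
    have := length_alt_le hs hgen k' i j
    omega
  have hvi : length s v ≤ length s (v * s i) ∧ length s v ≤ length s (v * s j) := by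
    by_cases h : Even k
    · rw [if_pos h] at hd hc
      exact ⟨hc, hd⟩
    · rw [if_neg h] at hd hc
      exact ⟨hd, hc⟩
  have hlt : length s v < n := by omega
  have hPi := ih _ hlt v i hvi.1 rfl
  have hPj := ih _ hlt v j hvi.2 rfl
  obtain ⟨x, y, hx, hy, hxy⟩ := alt_apply_root ρ α A hρ (hdiag i) (hdiag j) (hnonpos i j hij)
    (hnonpos j i hij.symm) (h3 i j hij) hkm
  rw [hv, map_mul, Module.End.mul_apply, hxy, map_add, map_smul, map_smul]
  exact hP _ hPi _ hPj x y hx hy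

end Roots

section Braid

variable {V : Type*} [AddCommGroup V] [Module ℝ V]

/-- The braid relation between two reflections in a rank two crystallographic configuration. -/
theorem alt_order_comm {ι : Type*} {f : ι → Module.Dual ℝ V} {c : ι → V} {A : ι → ι → ℤ}
    (hf : ∀ i j, f j (c i) = A i j) {s : ι → V ≃ₗ[ℝ] V} (hs : ∀ i x, s i x = x - f i x • c i)
    {i j : ι} (hi : A i i = 2) (hj : A j j = 2) (hij : A i j ≤ 0) (hji : A j i ≤ 0)
    (h0 : A i j = 0 → A j i = 0) (h0' : A j i = 0 → A i j = 0) (h3 : A i j * A j i ≤ 3) :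
    alt s (order (A i j * A j i)) i j = alt s (order (A i j * A j i)) j i := by
  -- both sides map `x` into `x + ℝ c_i + ℝ c_j`, and the coefficients are computed letter by letter
  have ei : ∀ x (p q : ℝ), s i (x - p • c i - q • c j) =
      x - (f i x - p - q * A j i) • c i - q • c j := by
    intro x p q
    rw [hs]
    simp only [map_sub, map_smul, hf, hi, smul_eq_mul]
    push_cast
    module
  have ej : ∀ x (p q : ℝ), s j (x - p • c i - q • c j) =
      x - p • c i - (f j x - q - p * A i j) • c j := by
    intro x p q
    rw [hs]
    simp only [map_sub, map_smul, hf, hj, smul_eq_mul]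
    push_cast
    module
  have ei0 : ∀ x, s i x = x - (f i x) • c i - (0 : ℝ) • c j := by
    intro x
    simpa using ei x 0 0
  have ej0 : ∀ x, s j x = x - (0 : ℝ) • c i - (f j x) • c j := by
    intro x
    simpa using ej x 0 0
  have hcase : (A i j = 0 ∧ A j i = 0) ∨ (A i j = -1 ∧ A j i = -1) ∨ (A i j = -1 ∧ A j i = -2) ∨
      (A i j = -2 ∧ A j i = -1) ∨ (A i j = -1 ∧ A j i = -3) ∨ (A i j = -3 ∧ A j i = -1) := by
    by_cases hz : A i j = 0
    · exact Or.inl ⟨hz, h0 hz⟩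
    · have hz' : A j i ≠ 0 := fun h => hz (h0' h)
      have h1 : A i j ≤ -1 := by omega
      have h2 : A j i ≤ -1 := by omega
      have h4 : -3 ≤ A i j := by nlinarith
      have h5 : -3 ≤ A j i := by nlinarith
      interval_cases A i j <;> interval_cases A j i <;> simp_all
  rcases hcase with ⟨ha, hb⟩ | ⟨ha, hb⟩ | ⟨ha, hb⟩ | ⟨ha, hb⟩ | ⟨ha, hb⟩ | ⟨ha, hb⟩ <;>
  · rw [hb] at ei
    rw [ha] at ej
    rw [ha, hb]
    refine LinearEquiv.ext fun x => ?_
    norm_num [order, alt]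
    simp only [ei0 x, ej0 x, ei, ej]
    push_cast
    module

end Braid

end CoxeterWord

/-! ### Affine Cartan matrices -/

namespace AffineCartanDatum

variable {n : ℕ} (D : AffineCartanDatum n)

/-- The kernel of an affine Cartan matrix is spanned by the marks, which are all positive, so it
contains no nonzero vector with vanishing `0`-th coordinate. -/
theorem eq_zero_of_mulVec_eq_zero {x : Fin (n + 1) → ℝ} (hx : ∀ i, ∑ j, (D.A i j : ℝ) * x j = 0)
    (hx0 : x 0 = 0) : x = 0 := by
  have hm : ∀ j, (0 : ℝ) < D.mark j := fun j => by exact_mod_cast D.mark_pos j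
  -- subtract the largest multiple of the null vector that leaves nonnegative coordinates
  obtain ⟨k, hk⟩ := Finite.exists_min fun j => x j / D.mark j
  set t := x k / D.mark k with ht
  set z : Fin (n + 1) → ℝ := fun j => x j - t * D.mark j with hz
  have hz0 : ∀ j, 0 ≤ z j := by
    intro j
    have := (le_div_iff₀ (hm j)).mp (hk j)
    simpa [hz] using this
  have hzk : z k = 0 := by simp [hz, ht, (hm k).ne']
  have hAz : ∀ i, ∑ j, (D.A i j : ℝ) * z j = 0 := by
    intro i
    have h1 : ∑ j, (D.A i j : ℝ) * D.mark j = 0 := by exact_mod_cast D.mark_null i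
    have h2 : ∑ j, (D.A i j : ℝ) * z j =
        ∑ j, (D.A i j : ℝ) * x j - t * ∑ j, (D.A i j : ℝ) * D.mark j := by
      rw [Finset.mul_sum, ← Finset.sum_sub_distrib]
      exact Finset.sum_congr rfl fun j _ => by simp only [hz]; ring
    rw [h2, hx, h1]; ring
  have hall : ∀ j, z j = 0 := by
    by_contra! hne
    obtain ⟨j, hj⟩ := hne
    obtain ⟨i, hi, l, hl, hil⟩ := D.indecomposable {j | z j = 0} ⟨k, hzk⟩ ⟨j, hj⟩
    have hterm : ∀ m, (D.A i m : ℝ) * z m ≤ 0 := by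
      intro m
      by_cases him : i = m
      · rw [← him, show z i = 0 from hi, mul_zero]
      · exact mul_nonpos_of_nonpos_of_nonneg (by exact_mod_cast D.nonpos i m him) (hz0 m)
    have hne : i ≠ l := by
      rintro rfl
      exact hl hi
    have hlt : (D.A i l : ℝ) * z l < 0 :=
      mul_neg_of_neg_of_pos (by exact_mod_cast lt_of_le_of_ne (D.nonpos i l hne) hil)
        (lt_of_le_of_ne (hz0 l) (Ne.symm hl))
    exact absurd (hAz i) (Finset.sum_neg' (fun m _ => hterm m) ⟨l, Finset.mem_univ l, hlt⟩).ne
  have ht0 : t = 0 := by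
    have := hall 0
    simp only [hz, hx0, zero_sub, neg_eq_zero, mul_eq_zero] at this
    exact this.resolve_right (hm 0).ne'
  funext j
  have := hall j
  simpa [hz, ht0] using this

/-- The quadratic form `Q` attached to a symmetrization `diag(d) A` of the Cartan matrix: it is
nonnegative, its isotropic vectors are in the kernel of `A`, and the last clause expands it along
the direction of a simple root. -/
theorem exists_form : ∃ (d : Fin (n + 1) → ℝ) (Q : (Fin (n + 1) → ℝ) → ℝ),
    (∀ i, 0 < d i) ∧ (∀ x, 0 ≤ Q x) ∧ (∀ x, Q x = 0 → ∀ i, ∑ j, (D.A i j : ℝ) * x j = 0) ∧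
    Q 0 = 0 ∧ ∀ x i t, Q (x - Pi.single i t) =
      Q x - 2 * t * d i * (∑ j, (D.A i j : ℝ) * x j) + 2 * t ^ 2 * d i := by
  obtain ⟨d, hd, hG⟩ := D.posSemidef
  set G := Matrix.diagonal d * D.A.map (fun z : ℤ => (z : ℝ)) with hGdef
  have hGi : ∀ x i, (G.mulVec x) i = d i * ∑ j, (D.A i j : ℝ) * x j := by
    intro x i
    rw [hGdef, ← Matrix.mulVec_mulVec, Matrix.mulVec_diagonal]
    rfl
  refine ⟨d, fun x => x ⬝ᵥ G.mulVec x, hd, fun x => ?_, fun x hx i => ?_, by simp, ?_⟩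
  · simpa using hG.dotProduct_mulVec_nonneg x
  · have := (hG.dotProduct_mulVec_zero_iff x).mp (by simpa using hx)
    have h := congrFun this i
    rw [hGi] at h
    simpa [(hd i).ne'] using h
  · intro x i t
    have hsymm : x ⬝ᵥ G.mulVec (Pi.single i t) = Pi.single i t ⬝ᵥ G.mulVec x := by
      rw [Matrix.dotProduct_mulVec, ← Matrix.mulVec_transpose, dotProduct_comm]
      have : G.IsSymm := by simpa using hG.isHermitian
      rw [this.eq]
    have h1 : Pi.single i t ⬝ᵥ G.mulVec x = t * (d i * ∑ j, (D.A i j : ℝ) * x j) := by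
      rw [single_dotProduct, hGi]
    have h2 : Pi.single i t ⬝ᵥ G.mulVec (Pi.single i t) = t * (d i * (2 * t)) := by
      rw [single_dotProduct, hGi]
      congr 2
      rw [Finset.sum_eq_single i]
      · rw [D.diag, Pi.single_eq_same]; norm_num
      · intro j _ hj
        rw [Pi.single_eq_of_ne hj, mul_zero]
      · simp
    simp only [Matrix.mulVec_sub, dotProduct_sub, sub_dotProduct, hsymm, h1, h2]
    ring

/-- As `Q` is positive definite on vectors with vanishing `0`-th coordinate, so is its restriction
to the plane of two simple roots. -/
theorem mul_le_three {i j : Fin (n + 1)} (hi : i ≠ 0) (hj : j ≠ 0) (hij : i ≠ j) :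
    D.A i j * D.A j i ≤ 3 := by
  obtain ⟨d, Q, hd, hQ, hQ0, h0, hs⟩ := D.exists_form
  have h1 : ∀ k t, Q (- Pi.single k t) = 2 * t ^ 2 * d k := by
    intro k t
    have := hs 0 k t
    simpa [h0] using this
  have h2 : ∀ k l t u, Q (- Pi.single k t - Pi.single l u) =
      2 * t ^ 2 * d k + 2 * t * u * (d l * D.A l k) + 2 * u ^ 2 * d l := by
    intro k l t u
    rw [hs, h1, Finset.sum_eq_single k]
    · simp only [Pi.neg_apply, Pi.single_eq_same]; ring
    · intro m _ hm
      simp [hm]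
    · simp
  have h3 : d i * D.A i j = d j * D.A j i := by
    have e1 := h2 i j 1 1
    have e2 := h2 j i 1 1
    rw [← neg_add', add_comm (Pi.single i _), neg_add', e2] at e1
    linarith
  -- the vector `2 α_j - a_{ij} α_i`, up to sign, has norm `2 d_j (4 - a_{ij} a_{ji})`
  have h4 := h2 j i 2 (-D.A i j)
  have h5 : Q (- Pi.single j 2 - Pi.single i (-(D.A i j : ℝ))) =
      2 * d j * (4 - D.A i j * D.A j i) := by
    rw [h4]
    linear_combination (-2 * (D.A i j : ℝ)) * h3
  by_contra hlt
  have h6 : (4 : ℝ) ≤ D.A i j * D.A j i := by exact_mod_cast (by omega : 4 ≤ D.A i j * D.A j i)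
  have h7 : Q (- Pi.single j 2 - Pi.single i (-(D.A i j : ℝ))) = 0 := by
    refine le_antisymm ?_ (hQ _)
    rw [h5]
    exact mul_nonpos_of_nonneg_of_nonpos (by linarith [hd j]) (by linarith)
  have h8 := D.eq_zero_of_mulVec_eq_zero (hQ0 _ h7) (by simp [hi.symm, hj.symm])
  have := congrFun h8 j
  simp [hij.symm] at this

/-- The set of integer vectors of a given norm with vanishing `0`-th coordinate is finite. -/
theorem finite_of_form {d : Fin (n + 1) → ℝ} {Q : (Fin (n + 1) → ℝ) → ℝ} (hd : ∀ i, 0 < d i)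
    (hQ : ∀ x, 0 ≤ Q x) (hs : ∀ x i t, Q (x - Pi.single i t) =
      Q x - 2 * t * d i * (∑ j, (D.A i j : ℝ) * x j) + 2 * t ^ 2 * d i) (R : ℝ) :
    {c : Fin (n + 1) → ℤ | c 0 = 0 ∧ Q (fun j => (c j : ℝ)) = R}.Finite := by
  set f : (Fin (n + 1) → ℤ) → (Fin (n + 1) → ℤ) := fun c i => ∑ j, D.A i j * c j with hf
  have hinj : Set.InjOn f {c : Fin (n + 1) → ℤ | c 0 = 0 ∧ Q (fun j => (c j : ℝ)) = R} := by
    rintro c ⟨hc, -⟩ c' ⟨hc', -⟩ h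
    have := D.eq_zero_of_mulVec_eq_zero (x := fun j => ((c j - c' j : ℤ) : ℝ)) (fun i => ?_)
      (by simp [hc, hc'])
    · funext j
      have := congrFun this j
      simp only [Pi.zero_apply, Int.cast_eq_zero] at this
      omega
    · have := congrFun h i
      simp only [hf] at this
      have h' : ∑ j, D.A i j * (c j - c' j) = 0 := by
        simp only [mul_sub, Finset.sum_sub_distrib, this, sub_self]
      exact_mod_cast h'
  obtain ⟨N, hN⟩ : ∃ N : ℕ, ∀ i, 2 * R / d i ≤ N := by
    obtain ⟨k, hk⟩ := Finite.exists_max fun i => 2 * R / d i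
    obtain ⟨N, hN⟩ := exists_nat_ge (2 * R / d k)
    exact ⟨N, fun i => (hk i).trans hN⟩
  refine Set.Finite.of_finite_image (Set.Finite.subset
    (Set.finite_Icc (fun _ => -(N : ℤ)) (fun _ => (N : ℤ))) ?_) hinj
  rintro _ ⟨c, ⟨-, hc⟩, rfl⟩
  -- Cauchy-Schwarz: the pairing of a vector of norm `R` with a simple root is bounded
  have key : ∀ i, (f c i) ^ 2 ≤ (N : ℤ) := by
    intro i
    have hfi : ∑ j, (D.A i j : ℝ) * (c j : ℝ) = (f c i : ℝ) := by simp [hf]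
    have h1 := hQ ((fun j => (c j : ℝ)) - Pi.single i ((f c i : ℝ) / 2))
    rw [hs, hc, hfi] at h1
    have h2 : (f c i : ℝ) ^ 2 ≤ 2 * R / d i := by
      rw [le_div_iff₀ (hd i)]
      nlinarith
    exact_mod_cast h2.trans (hN i)
  constructor <;> intro i <;> have := key i <;> simp only <;> nlinarith [sq_nonneg (f c i)]

/-! ### The level zero space -/

/-- The reflection `cl(s_i)` of the level `0` space. -/
noncomputable abbrev clS (i : Fin (n + 1)) : D.finiteWeylGroup := D.cl (D.s i)

theorem clS_apply (i : Fin (n + 1)) (x : D.levelZero) :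
    (((D.clS i : D.levelZero ≃ₗ[ℝ] D.levelZero) x : D.levelZero) : Fin (n + 1) → ℝ) =
      (x : Fin (n + 1) → ℝ) - (x : Fin (n + 1) → ℝ) i • D.coroot i := by
  exact Module.reflection_apply (x : Fin (n + 1) → ℝ) (D.proj_coroot i)

theorem s_mul_self (i : Fin (n + 1)) : D.s i * D.s i = 1 := by
  refine Subtype.ext (LinearEquiv.ext fun x => ?_)
  exact Module.involutive_reflection (D.proj_coroot i) x

theorem clS_mul_self (i : Fin (n + 1)) : D.clS i * D.clS i = 1 := by
  rw [clS, ← map_mul, s_mul_self, map_one]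

theorem clS_inv (i : Fin (n + 1)) : (D.clS i)⁻¹ = D.clS i :=
  inv_eq_of_mul_eq_one_left (D.clS_mul_self i)

/-- The action of the finite Weyl group on linear forms as a representation. -/
noncomputable def rootRep : D.finiteWeylGroup →* Module.End ℝ (Module.Dual ℝ D.levelZero) where
  toFun w :=
    { toFun := D.rootAction w
      map_add' := fun _ _ => rfl
      map_smul' := fun _ _ => rfl }
  map_one' := by
    refine LinearMap.ext fun φ => LinearMap.ext fun x => ?_
    change φ (((1⁻¹ : D.finiteWeylGroup) : D.levelZero ≃ₗ[ℝ] D.levelZero) x) = φ x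
    rw [inv_one]
    rfl
  map_mul' v w := by
    refine LinearMap.ext fun φ => LinearMap.ext fun x => ?_
    change φ ((((v * w)⁻¹ : D.finiteWeylGroup) : D.levelZero ≃ₗ[ℝ] D.levelZero) x) = _
    rw [mul_inv_rev]
    rfl

theorem rootRep_apply (w : D.finiteWeylGroup) (φ : Module.Dual ℝ D.levelZero) (x : D.levelZero) :
    D.rootRep w φ x = φ ((((w⁻¹ : D.finiteWeylGroup) : D.levelZero ≃ₗ[ℝ] D.levelZero)) x) := rfl

theorem clRoot_apply (i : Fin (n + 1)) (x : D.levelZero) :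
    D.clRoot i x = (x : Fin (n + 1) → ℝ) i := rfl

theorem rootRep_clS_apply (i : Fin (n + 1)) (φ : Module.Dual ℝ D.levelZero) (x : D.levelZero) :
    D.rootRep (D.clS i) φ x = φ ((D.clS i : D.levelZero ≃ₗ[ℝ] D.levelZero) x) := by
  rw [rootRep_apply, clS_inv]

theorem rootRep_clS (i k : Fin (n + 1)) :
    D.rootRep (D.clS i) (D.clRoot k) = D.clRoot k - (D.A i k : ℝ) • D.clRoot i := by
  refine LinearMap.ext fun x => ?_
  rw [rootRep_clS_apply, clRoot_apply, clS_apply]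
  simp [clRoot_apply, coroot, mul_comm]

theorem rootRep_clS_self (i : Fin (n + 1)) : D.rootRep (D.clS i) (D.clRoot i) = - D.clRoot i := by
  rw [rootRep_clS, D.diag]
  push_cast
  module

theorem mark_cast_pos (i : Fin (n + 1)) : (0 : ℝ) < D.mark i := by exact_mod_cast D.mark_pos i

theorem level_apply (x : Fin (n + 1) → ℝ) : D.level x = ∑ j, (D.mark j : ℝ) * x j := by
  simp [level]

theorem sum_mark_mul (x : D.levelZero) : ∑ j, (D.mark j : ℝ) * (x : Fin (n + 1) → ℝ) j = 0 := by
  rw [← level_apply]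
  exact x.2

theorem sum_mark_smul_clRoot : ∑ j, (D.mark j : ℝ) • D.clRoot j = 0 := by
  refine LinearMap.ext fun x => ?_
  simpa [LinearMap.sum_apply, clRoot_apply] using D.sum_mark_mul x

/-- The fundamental coweights of `W̊`: the basis of the level `0` space dual to the simple roots
`cl(α_1), …, cl(α_n)`, completed by `ω_0 = 0`. -/
noncomputable def omega (k : Fin (n + 1)) : D.levelZero :=
  ⟨Pi.single k 1 - Pi.single 0 ((D.mark k : ℝ) / D.mark 0), by
    rw [levelZero, LinearMap.mem_ker, level_apply]
    have h := (D.mark_cast_pos 0).ne'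
    simp only [Pi.sub_apply, mul_sub, Finset.sum_sub_distrib, Pi.single_apply, mul_ite, mul_zero,
      Finset.sum_ite_eq', Finset.mem_univ, if_true]
    field_simp
    ring⟩

theorem omega_apply {k j : Fin (n + 1)} (hj : j ≠ 0) :
    (D.omega k : Fin (n + 1) → ℝ) j = if j = k then 1 else 0 := by
  simp [omega, Pi.single_apply, hj]

theorem ext_levelZero {x y : D.levelZero}
    (h : ∀ j, j ≠ 0 → (x : Fin (n + 1) → ℝ) j = (y : Fin (n + 1) → ℝ) j) : x = y := by
  have h0 : ∀ z : D.levelZero, (∀ j, j ≠ 0 → (z : Fin (n + 1) → ℝ) j = 0) → z = 0 := by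
    intro z hz
    have h1 := D.sum_mark_mul z
    rw [Finset.sum_eq_single 0 (fun j _ hj => by rw [hz j hj, mul_zero]) (by simp)] at h1
    refine Subtype.ext (funext fun j => ?_)
    by_cases hj : j = 0
    · subst hj
      simpa [(D.mark_cast_pos 0).ne'] using h1
    · exact hz j hj
  rw [← sub_eq_zero]
  exact h0 _ fun j hj => by simpa [sub_eq_zero] using h j hj

theorem omega_zero : D.omega 0 = 0 :=
  D.ext_levelZero fun j hj => by rw [D.omega_apply hj, if_neg hj]; rfl

theorem eq_sum_omega (x : D.levelZero) : x = ∑ k, (x : Fin (n + 1) → ℝ) k • D.omega k := by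
  refine D.ext_levelZero fun j hj => ?_
  simp [D.omega_apply hj]

/-- The value `φ (ω_k)` is the coefficient of `cl(α_k)` in `φ`. -/
theorem dual_eq_sum (φ : Module.Dual ℝ D.levelZero) (x : D.levelZero) :
    φ x = ∑ k, (x : Fin (n + 1) → ℝ) k * φ (D.omega k) := by
  conv_lhs => rw [D.eq_sum_omega x]
  simp [map_sum]

theorem clS_omega {j k : Fin (n + 1)} (hj : j ≠ 0) (hjk : j ≠ k) :
    (D.clS j : D.levelZero ≃ₗ[ℝ] D.levelZero) (D.omega k) = D.omega k := by
  refine Subtype.ext ?_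
  rw [clS_apply, D.omega_apply hj, if_neg hjk, zero_smul, sub_zero]

theorem eq_one_of_rootRep_clRoot {w : D.finiteWeylGroup} (h : ∀ i, i ≠ 0 → D.rootRep w (D.clRoot i) =
    D.clRoot i) : w = 1 := by
  have h' : w⁻¹ = 1 := by
    refine Subtype.ext (LinearEquiv.ext fun x => D.ext_levelZero fun j hj => ?_)
    have := LinearMap.congr_fun (h j hj) x
    rw [rootRep_apply, clRoot_apply, clRoot_apply] at this
    exact this
  exact inv_eq_one.mp h'

/-! ### Finiteness of the finite Weyl group -/

variable {D}

theorem closure_eq_top (hD : D.IsProperlyLabelled) :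
    Subgroup.closure (Set.range fun i : {i : Fin (n + 1) // i ≠ 0} => D.clS i) = ⊤ := by
  rw [← hD]
  congr 1
  ext w
  simp

/-- Induction over words in `cl(s_1), …, cl(s_n)`. -/
theorem induction_simple (hD : D.IsProperlyLabelled) {p : D.finiteWeylGroup → Prop} (h1 : p 1)
    (hs : ∀ i, i ≠ 0 → ∀ w, p w → p (D.clS i * w)) (w : D.finiteWeylGroup) : p w := by
  have hw : w ∈ Subgroup.closure ((fun i => D.clS i) '' {i | i ≠ 0}) := by
    rw [show Subgroup.closure ((fun i => D.clS i) '' {i | i ≠ 0}) = ⊤ from hD]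
    trivial
  induction hw using Subgroup.closure_induction_left with
  | one => exact h1
  | mul_left x hx y _ hy =>
    obtain ⟨i, hi, rfl⟩ := hx
    exact hs i hi y hy
  | inv_mul_cancel x hx y _ hy =>
    obtain ⟨i, hi, rfl⟩ := hx
    simp only [clS_inv]
    exact hs i hi y hy

theorem finite_finiteWeylGroup (hD : D.IsProperlyLabelled) : Finite D.finiteWeylGroup := by
  obtain ⟨d, Q, hd, hQ, -, -, hs⟩ := D.exists_form
  -- the images of the simple roots have integer coordinates and the norm of simple roots
  have key : ∀ w : D.finiteWeylGroup, ∀ k, k ≠ 0 → ∃ c : Fin (n + 1) → ℤ, c 0 = 0 ∧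
      Q (fun j => (c j : ℝ)) = Q (Pi.single k 1) ∧
      D.rootRep w (D.clRoot k) = ∑ j, (c j : ℝ) • D.clRoot j := by
    intro w k hk
    induction w using induction_simple hD with
    | h1 =>
      refine ⟨Pi.single k 1, by simp [hk.symm], ?_, ?_⟩
      · congr 1
        ext j
        simp [Pi.single_apply]
      · simp [Pi.single_apply]
    | hs i hi w ih =>
      obtain ⟨c, hc0, hcQ, hc⟩ := ih
      refine ⟨c - Pi.single i (∑ j, D.A i j * c j), by simp [hc0, hi.symm], ?_, ?_⟩
      · rw [← hcQ]
        have h1 : (fun j => ((c - Pi.single i (∑ j, D.A i j * c j) : Fin (n + 1) → ℤ) j : ℝ)) =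
            (fun j => (c j : ℝ)) - Pi.single i (∑ j, (D.A i j : ℝ) * (c j : ℝ)) := by
          ext j
          by_cases hj : j = i
          · subst hj; simp
          · simp [hj]
        rw [h1, hs]
        ring
      · rw [map_mul, Module.End.mul_apply, hc, map_sum]
        have h1 : ∑ j, (Pi.single (M := fun _ => ℤ) i (∑ j, D.A i j * c j) j : ℝ) • D.clRoot j =
            ∑ j, (c j : ℝ) • (D.A i j : ℝ) • D.clRoot i := by
          rw [Finset.sum_eq_single i (fun j _ hj => by simp [hj]) (by simp), Pi.single_eq_same]
          simp only [smul_smul, ← Finset.sum_smul]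
          push_cast
          simp only [mul_comm]
        simp only [map_smul, rootRep_clS, smul_sub, Finset.sum_sub_distrib, Pi.sub_apply,
          Int.cast_sub]
        rw [← h1, ← Finset.sum_sub_distrib]
        exact Finset.sum_congr rfl fun j _ => (sub_smul _ _ _).symm
  choose c hc0 hcQ hc using key
  have hfin : ∀ k : {k : Fin (n + 1) // k ≠ 0},
      Finite {c : Fin (n + 1) → ℤ | c 0 = 0 ∧ Q (fun j => (c j : ℝ)) = Q (Pi.single k.1 1)} :=
    fun k => D.finite_of_form hd hQ hs _
  refine Finite.of_injective (β := ∀ k : {k : Fin (n + 1) // k ≠ 0},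
    {c : Fin (n + 1) → ℤ | c 0 = 0 ∧ Q (fun j => (c j : ℝ)) = Q (Pi.single k.1 1)})
    (fun w k => ⟨c w k.1 k.2, hc0 w k.1 k.2, hcQ w k.1 k.2⟩) fun v w h => ?_
  have h1 : ∀ k, k ≠ 0 → D.rootRep v (D.clRoot k) = D.rootRep w (D.clRoot k) := by
    intro k hk
    have : c v k hk = c w k hk := congrArg Subtype.val (congrFun h ⟨k, hk⟩)
    rw [hc v k hk, hc w k hk, this]
  rw [← inv_mul_eq_one]
  refine D.eq_one_of_rootRep_clRoot fun i hi => ?_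
  rw [map_mul, Module.End.mul_apply, ← h1 i hi, ← Module.End.mul_apply, ← map_mul, inv_mul_cancel,
    map_one]
  rfl

/-! ### Positive roots -/

variable (D) in
/-- The sum of the fundamental coweights, a point of the fundamental chamber. -/
noncomputable def rho : D.levelZero := ∑ k, D.omega k

theorem rho_apply {j : Fin (n + 1)} (hj : j ≠ 0) : (D.rho : Fin (n + 1) → ℝ) j = 1 := by
  simp [rho, D.omega_apply hj]

theorem rho_mem_chamber : D.rho ∈ D.chamber := fun i hi => by
  rw [clRoot_apply, rho_apply hi]
  exact one_pos

/-- A positive linear form is a nonnegative combination of simple roots. -/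
theorem IsPositive.nonneg {φ : Module.Dual ℝ D.levelZero} (h : D.IsPositive φ)
    (k : Fin (n + 1)) : 0 ≤ φ (D.omega k) := by
  by_contra! hk
  have hρ := h _ (rho_mem_chamber (D := D))
  set ε := -φ (D.omega k) / (2 * φ D.rho) with hε
  have hε0 : 0 < ε := div_pos (by linarith) (by linarith)
  -- a point of the chamber close to `ω_k`, on which the form would still be negative
  have := h (D.omega k + ε • D.rho) fun i hi => by
    rw [map_add, map_smul, clRoot_apply, clRoot_apply, rho_apply hi, D.omega_apply hi]
    split_ifs <;> simp <;> linarith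
  rw [map_add, map_smul, smul_eq_mul, hε] at this
  field_simp at this
  linarith

theorem isPositive_of_nonneg {φ : Module.Dual ℝ D.levelZero} (h : ∀ k, 0 ≤ φ (D.omega k))
    (h0 : φ ≠ 0) : D.IsPositive φ := by
  intro x hx
  obtain ⟨k, hk⟩ : ∃ k, φ (D.omega k) ≠ 0 := by
    by_contra! hall
    refine h0 (LinearMap.ext fun x => ?_)
    rw [D.dual_eq_sum φ x]
    simp [hall]
  have hterm : ∀ j, 0 ≤ (x : Fin (n + 1) → ℝ) j * φ (D.omega j) := by
    intro j
    by_cases hj : j = 0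
    · rw [hj, omega_zero, map_zero, mul_zero]
    · exact mul_nonneg (hx j hj).le (h j)
  have hk0 : k ≠ 0 := by
    rintro rfl
    rw [omega_zero, map_zero] at hk
    exact hk rfl
  rw [D.dual_eq_sum φ x]
  exact Finset.sum_pos' (fun j _ => hterm j)
    ⟨k, Finset.mem_univ k, mul_pos (hx k hk0) (lt_of_le_of_ne (h k) hk.symm)⟩

theorem IsPositive.not_neg {φ : Module.Dual ℝ D.levelZero} (h : D.IsPositive φ) :
    ¬ D.IsPositive (-φ) := by
  intro h'
  have h1 := h _ (rho_mem_chamber (D := D))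
  have h2 := h' _ (rho_mem_chamber (D := D))
  rw [LinearMap.neg_apply] at h2
  linarith

theorem isPositive_smul_iff {φ : Module.Dual ℝ D.levelZero} {c : ℝ} (hc : 0 < c) :
    D.IsPositive (c • φ) ↔ D.IsPositive φ := by
  simp only [IsPositive, LinearMap.smul_apply, smul_eq_mul, hc, mul_pos_iff_of_pos_left]

variable (D) in
/-- The coroot `α_i^∨` as an element of the level `0` space. -/
noncomputable def corootZero (i : Fin (n + 1)) : D.levelZero := ⟨D.coroot i, D.level_coroot i⟩

theorem clRoot_corootZero (i : Fin (n + 1)) : D.clRoot i (D.corootZero i) = 2 := D.proj_coroot i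

theorem clS_apply_eq (i : Fin (n + 1)) (x : D.levelZero) :
    (D.clS i : D.levelZero ≃ₗ[ℝ] D.levelZero) x = x - D.clRoot i x • D.corootZero i :=
  Subtype.ext (D.clS_apply i x)

theorem clRoot_ne_zero (i : Fin (n + 1)) : D.clRoot i ≠ 0 := by
  intro h
  have := clRoot_corootZero (D := D) i
  rw [h] at this
  norm_num at this

theorem rootRep_injective (w : D.finiteWeylGroup) {φ : Module.Dual ℝ D.levelZero}
    (h : D.rootRep w φ = 0) : φ = 0 := by
  have : D.rootRep w⁻¹ (D.rootRep w φ) = φ := by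
    rw [← Module.End.mul_apply, ← map_mul, inv_mul_cancel, map_one]
    rfl
  rw [← this, h, map_zero]

theorem rootRep_mul_clS (w : D.finiteWeylGroup) (i : Fin (n + 1)) :
    D.rootRep (w * D.clS i) (D.clRoot i) = - D.rootRep w (D.clRoot i) := by
  rw [map_mul, Module.End.mul_apply, rootRep_clS_self, map_neg]

theorem clS_ne_one (i : Fin (n + 1)) : D.clS i ≠ 1 := by
  intro h
  have := LinearMap.congr_fun (D.rootRep_clS_self i) (D.corootZero i)
  rw [h, map_one, Module.End.one_apply, LinearMap.neg_apply, clRoot_corootZero] at this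
  norm_num at this

variable (D) in
/-- The length of an element of `W̊` with respect to `cl(s_1), …, cl(s_n)`. -/
noncomputable def len (w : D.finiteWeylGroup) : ℕ :=
  CoxeterWord.length (fun i : {i : Fin (n + 1) // i ≠ 0} => D.clS i) w

theorem alt_clS {i j : {i : Fin (n + 1) // i ≠ 0}} (hij : i ≠ j) :
    CoxeterWord.alt (fun i : {i : Fin (n + 1) // i ≠ 0} => D.clS i)
        (CoxeterWord.order (D.A i j * D.A j i)) i j =
      CoxeterWord.alt (fun i : {i : Fin (n + 1) // i ≠ 0} => D.clS i)
        (CoxeterWord.order (D.A i j * D.A j i)) j i := by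
  have hij' : (i : Fin (n + 1)) ≠ j := fun h => hij (Subtype.ext h)
  rw [← CoxeterWord.map_alt D.cl, ← CoxeterWord.map_alt D.cl]
  congr 1
  refine Subtype.ext ?_
  have h1 := CoxeterWord.map_alt D.affineWeylGroup.subtype
    (fun i : {i : Fin (n + 1) // i ≠ 0} => D.s i) (CoxeterWord.order (D.A i j * D.A j i))
  refine (h1 i j).trans (Eq.trans ?_ (h1 j i).symm)
  exact CoxeterWord.alt_order_comm
    (f := fun i : {i : Fin (n + 1) // i ≠ 0} => LinearMap.proj (i : Fin (n + 1)))
    (c := fun i => D.coroot i) (A := fun i j => D.A i j) (fun i j => rfl)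
    (fun i x => Module.reflection_apply x (D.proj_coroot i))
    (D.diag i) (D.diag j) (D.nonpos i j hij') (D.nonpos j i hij'.symm)
    (D.zero_symm i j) (D.zero_symm j i) (D.mul_le_three i.2 j.2 hij')

theorem isPositive_of_len_le (hD : D.IsProperlyLabelled) {w : D.finiteWeylGroup}
    {i : Fin (n + 1)} (hi : i ≠ 0) (h : D.len w ≤ D.len (w * D.clS i)) :
    D.IsPositive (D.rootRep w (D.clRoot i)) := by
  refine isPositive_of_nonneg ?_ fun h' => clRoot_ne_zero i (rootRep_injective w h')
  refine CoxeterWord.apply_root_mem_of_length_le (E := Module.Dual ℝ D.levelZero)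
    (ι := {i : Fin (n + 1) // i ≠ 0}) (s := fun i => D.clS i)
    D.rootRep (fun i => D.clRoot i) (fun i j => D.A i j)
    (fun i => D.clS_mul_self i) (closure_eq_top hD) (fun i k => D.rootRep_clS i k)
    (fun i => D.diag i) (fun i j hij => D.nonpos i j fun h => hij (Subtype.ext h))
    (fun i j hij => D.mul_le_three i.2 j.2 fun h => hij (Subtype.ext h))
    (fun i j hij => alt_clS hij) (P := {φ | ∀ k, 0 ≤ φ (D.omega k)}) ?_ ?_ w ⟨i, hi⟩ h
  · intro i k
    rw [clRoot_apply, D.omega_apply i.2]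
    split_ifs <;> norm_num
  · intro x hx y hy a b ha hb k
    rw [LinearMap.add_apply, LinearMap.smul_apply, LinearMap.smul_apply]
    exact add_nonneg (mul_nonneg ha (hx k)) (mul_nonneg hb (hy k))

theorem isPositive_neg_of_len_lt (hD : D.IsProperlyLabelled) {w : D.finiteWeylGroup}
    {i : Fin (n + 1)} (hi : i ≠ 0) (h : D.len (w * D.clS i) < D.len w) :
    D.IsPositive (-D.rootRep w (D.clRoot i)) := by
  rw [← rootRep_mul_clS]
  refine isPositive_of_len_le hD hi ?_
  rw [mul_assoc, clS_mul_self, mul_one]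
  exact h.le

theorem exists_isPositive_neg (hD : D.IsProperlyLabelled) {w : D.finiteWeylGroup} (hw : w ≠ 1) :
    ∃ i, i ≠ 0 ∧ D.IsPositive (-D.rootRep w (D.clRoot i)) := by
  obtain ⟨i, hi⟩ := CoxeterWord.exists_length_mul_lt
    (s := fun i : {i : Fin (n + 1) // i ≠ 0} => D.clS i)
    (fun i => D.clS_mul_self i) (closure_eq_top hD) hw
  exact ⟨i, i.2, isPositive_neg_of_len_lt hD i.2 hi⟩

/-- Every root `w(cl(α_i))`, including the case `i = 0`, is positive or negative. -/
theorem isPositive_or_neg (hD : D.IsProperlyLabelled) (w : D.finiteWeylGroup) (i : Fin (n + 1)) :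
    D.IsPositive (D.rootRep w (D.clRoot i)) ∨ D.IsPositive (-D.rootRep w (D.clRoot i)) := by
  by_contra! hcon
  obtain ⟨h1, h2⟩ := hcon
  simp only [IsPositive, not_forall, not_lt, LinearMap.neg_apply] at h1 h2
  set φ := D.rootRep w (D.clRoot i) with hφ
  obtain ⟨x, hx, hφx⟩ := h1
  obtain ⟨y, hy, hφy⟩ := h2
  -- the hyperplane of the root meets the chamber
  obtain ⟨q, hq, hφq⟩ : ∃ q ∈ D.chamber, φ q = 0 := by
    by_cases h0 : φ x = 0
    · exact ⟨x, hx, h0⟩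
    · refine ⟨φ y • x + (-φ x) • y, fun j hj => ?_, ?_⟩
      · rw [map_add, map_smul, map_smul]
        exact add_pos_of_nonneg_of_pos (mul_nonneg (by linarith) (hx j hj).le)
          (mul_pos (by linarith [lt_of_le_of_ne hφx h0]) (hy j hj))
      · rw [map_add, map_smul, map_smul, smul_eq_mul, smul_eq_mul]
        ring
  -- so the reflection in this hyperplane fixes a point of the chamber
  have hr : w * D.clS i * w⁻¹ ≠ 1 := fun h => clS_ne_one (D := D) i (by
    rw [mul_inv_eq_one] at h
    exact mul_eq_left.mp h)
  obtain ⟨j, hj, hneg⟩ := exists_isPositive_neg hD hr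
  have h3 := hneg q hq
  have h4 : (((w * D.clS i * w⁻¹)⁻¹ : D.finiteWeylGroup) : D.levelZero ≃ₗ[ℝ] D.levelZero) q =
      q := by
    have h5 : (w * D.clS i * w⁻¹)⁻¹ = w * D.clS i * w⁻¹ := by
      rw [mul_inv_rev, mul_inv_rev, clS_inv, inv_inv, mul_assoc]
    rw [h5]
    change (w : D.levelZero ≃ₗ[ℝ] D.levelZero) ((D.clS i : D.levelZero ≃ₗ[ℝ] D.levelZero)
      (((w⁻¹ : D.finiteWeylGroup) : D.levelZero ≃ₗ[ℝ] D.levelZero) q)) = q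
    rw [clS_apply_eq, ← rootRep_apply, ← hφ, hφq, zero_smul, sub_zero]
    exact LinearEquiv.apply_symm_apply _ q
  rw [LinearMap.neg_apply, rootRep_apply, h4] at h3
  linarith [hq j hj]

theorem not_isPositive_iff (hD : D.IsProperlyLabelled) (w : D.finiteWeylGroup)
    (i : Fin (n + 1)) : ¬ D.IsPositive (D.rootRep w (D.clRoot i)) ↔
      D.IsPositive (-D.rootRep w (D.clRoot i)) :=
  ⟨(isPositive_or_neg hD w i).resolve_left, fun h h' => h'.not_neg h⟩

/-- Reflections of a finite group whose roots are proportional are equal; here the reflections are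
`w cl(s_i) w⁻¹` and `cl(s_j)`. -/
theorem mul_clS_of_rootRep_eq_smul [Finite D.finiteWeylGroup] {w : D.finiteWeylGroup}
    {i j : Fin (n + 1)} {c : ℝ} (h : D.rootRep w (D.clRoot i) = c • D.clRoot j) :
    w * D.clS i = D.clS j * w := by
  set t := w * D.clS i * w⁻¹ * D.clS j with ht
  set v : D.levelZero := (w : D.levelZero ≃ₗ[ℝ] D.levelZero) (D.corootZero i) with hv
  set z : D.levelZero := c • v - D.corootZero j with hz
  have hwv : c * D.clRoot j v = 2 := by
    have := LinearMap.congr_fun h v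
    rw [rootRep_apply, LinearMap.smul_apply, smul_eq_mul] at this
    rw [← this, hv, ← clRoot_corootZero (D := D) i]
    congr 1
    exact LinearEquiv.symm_apply_apply _ _
  have hjz : D.clRoot j z = 0 := by
    rw [hz, map_sub, map_smul, clRoot_corootZero, smul_eq_mul, hwv, sub_self]
  have htx : ∀ x, (t : D.levelZero ≃ₗ[ℝ] D.levelZero) x = x + D.clRoot j x • z := by
    intro x
    change (w : D.levelZero ≃ₗ[ℝ] D.levelZero) ((D.clS i : D.levelZero ≃ₗ[ℝ] D.levelZero)
      (((w⁻¹ : D.finiteWeylGroup) : D.levelZero ≃ₗ[ℝ] D.levelZero)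
        ((D.clS j : D.levelZero ≃ₗ[ℝ] D.levelZero) x))) = _
    rw [clS_apply_eq i, ← rootRep_apply, h, map_sub, map_smul, ← hv]
    have : (w : D.levelZero ≃ₗ[ℝ] D.levelZero)
        (((w⁻¹ : D.finiteWeylGroup) : D.levelZero ≃ₗ[ℝ] D.levelZero)
          ((D.clS j : D.levelZero ≃ₗ[ℝ] D.levelZero) x)) =
        (D.clS j : D.levelZero ≃ₗ[ℝ] D.levelZero) x := LinearEquiv.apply_symm_apply _ _
    rw [this, clS_apply_eq, LinearMap.smul_apply, map_sub, map_smul, clRoot_corootZero, hz]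
    simp only [smul_eq_mul]
    module
  -- `t` is unipotent of finite order, hence trivial
  have hpow : ∀ k : ℕ, ∀ x, ((t ^ k : D.finiteWeylGroup) : D.levelZero ≃ₗ[ℝ] D.levelZero) x =
      x + (k * D.clRoot j x) • z := by
    intro k
    induction k with
    | zero => intro x; simp
    | succ k ih =>
      intro x
      rw [pow_succ]
      change ((t ^ k : D.finiteWeylGroup) : D.levelZero ≃ₗ[ℝ] D.levelZero)
        ((t : D.levelZero ≃ₗ[ℝ] D.levelZero) x) = _
      rw [htx, ih, map_add, map_smul, hjz]
      push_cast
      simp only [smul_eq_mul, mul_zero, add_zero]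
      module
  have hz0 : z = 0 := by
    have h1 := hpow (orderOf t) (D.corootZero j)
    rw [pow_orderOf_eq_one, clRoot_corootZero] at h1
    have h2 : ((orderOf t : ℝ) * 2) • z = 0 := by
      have h3 : ((1 : D.finiteWeylGroup) : D.levelZero ≃ₗ[ℝ] D.levelZero) (D.corootZero j) =
        D.corootZero j := rfl
      rw [h3] at h1
      exact left_eq_add.mp h1
    refine (smul_eq_zero.mp h2).resolve_left ?_
    have := orderOf_pos t
    positivity
  have ht1 : t = 1 := by
    refine Subtype.ext (LinearEquiv.ext fun x => ?_)
    rw [htx, hz0, smul_zero, add_zero]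
    rfl
  rw [ht, mul_eq_one_iff_eq_inv, clS_inv, mul_inv_eq_iff_eq_mul] at ht1
  exact ht1

/-- The fundamental coweight `ω_k` is fixed by the parabolic subgroups that avoid `cl(s_k)`. -/
theorem apply_omega_of_mem_parabolic {I : Set (Fin (n + 1))} (hI : I ⊆ {i | i ≠ 0})
    {u : D.finiteWeylGroup} (hu : u ∈ Subgroup.closure ((fun i => D.clS i) '' I))
    {k : Fin (n + 1)} (hk : k ∉ I) :
    (u : D.levelZero ≃ₗ[ℝ] D.levelZero) (D.omega k) = D.omega k := by
  have hs : ∀ i ∈ I, (D.clS i : D.levelZero ≃ₗ[ℝ] D.levelZero) (D.omega k) = D.omega k :=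
    fun i hi => D.clS_omega (hI hi) fun h => hk (h ▸ hi)
  induction hu using Subgroup.closure_induction'' with
  | mem u hu => obtain ⟨i, hi, rfl⟩ := hu; exact hs i hi
  | inv_mem u hu => obtain ⟨i, hi, rfl⟩ := hu; simp only [clS_inv]; exact hs i hi
  | one => rfl
  | mul a b _ _ ha hb =>
    exact (congrArg (a : D.levelZero ≃ₗ[ℝ] D.levelZero) hb).trans ha

theorem rootRep_inv_omega_of_mem_parabolic {I : Set (Fin (n + 1))} (hI : I ⊆ {i | i ≠ 0})
    {u : D.finiteWeylGroup} (hu : u ∈ Subgroup.closure ((fun i => D.clS i) '' I))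
    {k : Fin (n + 1)} (hk : k ∉ I) (φ : Module.Dual ℝ D.levelZero) :
    D.rootRep u⁻¹ φ (D.omega k) = φ (D.omega k) := by
  rw [rootRep_apply, inv_inv, apply_omega_of_mem_parabolic hI hu hk]

/-- If `y` makes all `cl(α_k)`, `k ∈ I`, negative, then it makes every nonzero nonnegative
combination of them negative. -/
theorem isPositive_neg_rootRep {I : Set (Fin (n + 1))} {y : D.finiteWeylGroup}
    (hy : ∀ k ∈ I, D.IsPositive (-D.rootRep y (D.clRoot k))) {φ : Module.Dual ℝ D.levelZero}
    (hφ : D.IsPositive φ) (hφI : ∀ k ∉ I, φ (D.omega k) = 0) :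
    D.IsPositive (-D.rootRep y φ) := by
  intro x hx
  have hterm : ∀ k, (((y⁻¹ : D.finiteWeylGroup) : D.levelZero ≃ₗ[ℝ] D.levelZero) x :
      Fin (n + 1) → ℝ) k * φ (D.omega k) ≤ 0 := by
    intro k
    by_cases hk : k ∈ I
    · have := hy k hk x hx
      rw [LinearMap.neg_apply, rootRep_apply, clRoot_apply] at this
      exact mul_nonpos_of_nonpos_of_nonneg (by linarith) (hφ.nonneg k)
    · rw [hφI k hk, mul_zero]
  obtain ⟨k, hk⟩ : ∃ k, φ (D.omega k) ≠ 0 := by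
    by_contra! hall
    have := hφ _ (rho_mem_chamber (D := D))
    rw [D.dual_eq_sum] at this
    simp [hall] at this
  have hkI : k ∈ I := by
    by_contra h
    exact hk (hφI k h)
  rw [LinearMap.neg_apply, rootRep_apply, D.dual_eq_sum, neg_pos]
  refine Finset.sum_neg' (fun k _ => hterm k) ⟨k, Finset.mem_univ k, ?_⟩
  have := hy k hkI x hx
  rw [LinearMap.neg_apply, rootRep_apply, clRoot_apply] at this
  exact mul_neg_of_neg_of_pos (by linarith) (lt_of_le_of_ne (hφ.nonneg k) hk.symm)

/-- The folding condition: as `cl(s_j)` only changes the coefficient of `cl(α_j)`, a positive root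
that it makes negative is proportional to `cl(α_j)`. -/
theorem clS_mul_eq_of_isPositive (hD : D.IsProperlyLabelled) {i j : Fin (n + 1)} (hj : j ≠ 0)
    {w : D.finiteWeylGroup} (h1 : D.IsPositive (D.rootRep w (D.clRoot i)))
    (h2 : ¬ D.IsPositive (D.rootRep (D.clS j * w) (D.clRoot i))) :
    D.clS j * w = w * D.clS i := by
  have := finite_finiteWeylGroup hD
  rw [not_isPositive_iff hD] at h2
  refine (mul_clS_of_rootRep_eq_smul (c := D.rootRep w (D.clRoot i) (D.omega j)) ?_).symm
  have h3 : ∀ k, k ≠ j → D.rootRep w (D.clRoot i) (D.omega k) = 0 := by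
    intro k hk
    have h4 := h2.nonneg k
    rw [map_mul, Module.End.mul_apply, LinearMap.neg_apply, rootRep_clS_apply,
      D.clS_omega hj hk.symm] at h4
    linarith [h1.nonneg k]
  refine LinearMap.ext fun x => ?_
  rw [D.dual_eq_sum, Finset.sum_eq_single j (fun k _ hk => by rw [h3 k hk, mul_zero]) (by simp),
    LinearMap.smul_apply, clRoot_apply, smul_eq_mul, mul_comm]

/-- The combinatorial data of `W̊`, with the projections associated to `cl(α_0), …, cl(α_n)`. -/
noncomputable def combinatorics (hD : D.IsProperlyLabelled) :
    ReflectionCombinatorics (Fin (n + 1)) D.finiteWeylGroup where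
  s := fun i => D.clS i
  simple := {i | i ≠ 0}
  Up i w := D.IsPositive (D.rootAction w (D.clRoot i))
  len := D.len
  weight w i := D.mark i * D.rootRep w (D.clRoot i) D.rho
  s_mul_self := D.clS_mul_self
  up_mul_s i w := by
    change D.IsPositive (D.rootRep (w * D.clS i) (D.clRoot i)) ↔ _
    rw [rootRep_mul_clS]
    exact (not_isPositive_iff hD w i).symm
  up_iff_len i hi w := by
    refine ⟨fun h => ?_, fun h => isPositive_of_len_le hD hi h.le⟩
    by_contra! hle
    refine IsPositive.not_neg h ?_
    change D.IsPositive (-D.rootRep w (D.clRoot i))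
    rw [← rootRep_mul_clS]
    refine isPositive_of_len_le hD hi ?_
    rwa [mul_assoc, clS_mul_self, mul_one]
  len_mul_le i hi w := by
    refine (CoxeterWord.length_mul_le
      (s := fun i : {i : Fin (n + 1) // i ≠ 0} => D.clS i) (fun i => D.clS_mul_self i) (closure_eq_top hD) _ _).trans ?_
    exact Nat.add_le_add_left (CoxeterWord.length_s_le
      (s := fun i : {i : Fin (n + 1) // i ≠ 0} => D.clS i) ⟨i, hi⟩) _
  len_inv := CoxeterWord.length_inv (s := fun i : {i : Fin (n + 1) // i ≠ 0} => D.clS i)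
    (fun i => D.clS_mul_self i) (closure_eq_top hD)
  exists_not_up w hw := by
    obtain ⟨i, hi, h⟩ := exists_isPositive_neg hD hw
    exact ⟨i, hi, (not_isPositive_iff hD w i).mpr h⟩
  fold j hj i w h1 h2 := clS_mul_eq_of_isPositive hD hj h1 h2
  closure_simple := hD
  up_inv_of_mem_parabolic I hI u hu i hi hiI := by
    change D.IsPositive (D.rootRep u⁻¹ (D.clRoot i))
    by_contra h
    rw [not_isPositive_iff hD] at h
    have := h.nonneg i
    rw [LinearMap.neg_apply, rootRep_inv_omega_of_mem_parabolic hI hu hiI, clRoot_apply,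
      D.omega_apply hi, if_pos rfl] at this
    linarith
  up_inv_mul_iff I hI x hx u hu i hi := by
    change D.IsPositive (D.rootRep (u * x)⁻¹ (D.clRoot i)) ↔
      ¬ D.IsPositive (D.rootRep u⁻¹ (D.clRoot i))
    have hx' : ∀ k ∈ I, D.IsPositive (-D.rootRep x⁻¹ (D.clRoot k)) :=
      fun k hk => (not_isPositive_iff hD x⁻¹ k).mp (hx k hk)
    have h0 : ∀ k ∉ I, D.rootRep u⁻¹ (D.clRoot i) (D.omega k) = 0 := by
      intro k hk
      rw [rootRep_inv_omega_of_mem_parabolic hI hu hk, clRoot_apply, D.omega_apply (hI hi),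
        if_neg]
      rintro rfl
      exact hk hi
    rw [mul_inv_rev, map_mul, Module.End.mul_apply]
    refine ⟨fun h h' => h.not_neg (isPositive_neg_rootRep hx' h' h0), fun h => ?_⟩
    rw [not_isPositive_iff hD] at h
    have := isPositive_neg_rootRep hx' h fun k hk => by rw [LinearMap.neg_apply, h0 k hk, neg_zero]
    rwa [map_neg, neg_neg] at this
  up_iff_weight i w := by
    refine ⟨fun h => mul_pos (D.mark_cast_pos i) (h _ rho_mem_chamber), fun h => ?_⟩
    refine (isPositive_or_neg hD w i).resolve_right fun h' => ?_
    have h1 := h' _ (rho_mem_chamber (D := D))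
    rw [LinearMap.neg_apply] at h1
    have := (mul_pos_iff_of_pos_left (D.mark_cast_pos i)).mp h
    linarith
  weight_mul_s i w := by
    rw [rootRep_mul_clS, LinearMap.neg_apply, mul_neg]
  weight_sum w := by
    have := congrArg (fun φ => D.rootRep w φ D.rho) D.sum_mark_smul_clRoot
    simpa [map_sum, LinearMap.sum_apply] using this

/-! ### Generators of the Hecke group algebra -/

theorem adjoin_projOp_eq (hD : D.IsProperlyLabelled) :
    Algebra.adjoin ℂ (Set.range D.projOp) = D.heckeGroupAlgebra := by
  have := finite_finiteWeylGroup hD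
  exact (combinatorics hD).adjoin_op_eq.trans (combinatorics hD).heckeGroup_eq.symm

theorem rightMulOp_mul (v w : D.finiteWeylGroup) :
    D.rightMulOp v * D.rightMulOp w = D.rightMulOp (w * v) := by
  refine Finsupp.lhom_ext fun x c => ?_
  simp [rightMulOp, Module.End.mul_apply, Finsupp.lmapDomain_apply, Finsupp.mapDomain_single,
    mul_assoc]

theorem rightMulOp_pow (v : D.finiteWeylGroup) (k : ℕ) :
    D.rightMulOp v ^ k = D.rightMulOp (v ^ k) := by
  induction k with
  | zero =>
    refine Finsupp.lhom_ext fun x c => ?_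
    simp [rightMulOp, Finsupp.lmapDomain_apply, Finsupp.mapDomain_single]
  | succ k ih => rw [pow_succ', ih, rightMulOp_mul, pow_succ]

/-- If `v` maps `cl(α_i)` to a positive multiple of `cl(α_j)`, then `π_i` is conjugate to `π_j`. -/
theorem projOp_eq_conj [Finite D.finiteWeylGroup] {v : D.finiteWeylGroup} {i j : Fin (n + 1)}
    {c : ℝ} (hc : 0 < c) (h : D.rootAction v (D.clRoot i) = c • D.clRoot j) :
    D.projOp i = D.rightMulOp v * D.projOp j * D.rightMulOp v⁻¹ := by
  have h1 : v * D.clS i = D.clS j * v := mul_clS_of_rootRep_eq_smul h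
  have h2 : ∀ w, D.IsPositive (D.rootAction w (D.clRoot i)) ↔
      D.IsPositive (D.rootAction (w * v⁻¹) (D.clRoot j)) := by
    intro w
    rw [← isPositive_smul_iff hc (φ := D.rootAction (w * v⁻¹) (D.clRoot j))]
    have : c • D.rootRep (w * v⁻¹) (D.clRoot j) = D.rootRep w (D.clRoot i) := by
      rw [← map_smul, ← h]
      change D.rootRep (w * v⁻¹) (D.rootRep v (D.clRoot i)) = _
      rw [← Module.End.mul_apply, ← map_mul, inv_mul_cancel_right]
    exact iff_of_eq (congrArg D.IsPositive this.symm)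
  have h3 : ∀ w, D.projAct i w = D.projAct j (w * v⁻¹) * v := by
    intro w
    by_cases hw : D.IsPositive (D.rootAction w (D.clRoot i))
    · rw [projAct, projAct, if_pos hw, if_pos ((h2 w).mp hw), mul_assoc, ← h1, ← mul_assoc,
        inv_mul_cancel_right]
    · rw [projAct, projAct, if_neg hw, if_neg (fun h => hw ((h2 w).mpr h)), inv_mul_cancel_right]
  refine Finsupp.lhom_ext fun x c => ?_
  simp [rightMulOp, projOp, Module.End.mul_apply, Finsupp.lmapDomain_apply,
    Finsupp.mapDomain_single, h3]

end AffineCartanDatum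

theorem mainTheorem5 (n : ℕ) (D : AffineCartanDatum n) (hD : D.IsProperlyLabelled) :
    Algebra.adjoin ℂ (Set.range D.projOp) = D.heckeGroupAlgebra ∧
    ∀ Ω : D.affineWeylGroup,
      (∃ i : Fin (n + 1), i ≠ 0 ∧ ∃ c : ℝ, 0 < c ∧
        D.rootAction (D.cl Ω) (D.clRoot 0) = c • D.clRoot i) →
      Algebra.adjoin ℂ (insert (D.rightMulOp (D.cl Ω)) (D.projOp '' {i | i ≠ 0})) =
        D.heckeGroupAlgebra := by
  have hfin := AffineCartanDatum.finite_finiteWeylGroup hD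
  refine ⟨AffineCartanDatum.adjoin_projOp_eq hD, ?_⟩
  rintro Ω ⟨i, hi, c, hc, h⟩
  refine le_antisymm (Algebra.adjoin_le ?_) ?_
  · rintro _ (rfl | ⟨j, hj, rfl⟩)
    · exact (le_sup_right : _ ≤ D.zeroHeckeAlgebra ⊔ _) (Algebra.subset_adjoin ⟨_, rfl⟩)
    · exact (le_sup_left : _ ≤ _ ⊔ D.groupAlgebra) (Algebra.subset_adjoin ⟨j, hj, rfl⟩)
  · rw [← AffineCartanDatum.adjoin_projOp_eq hD]
    refine Algebra.adjoin_le ?_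
    have hΩ : D.rightMulOp (D.cl Ω) ∈
        Algebra.adjoin ℂ (insert (D.rightMulOp (D.cl Ω)) (D.projOp '' {i | i ≠ 0})) :=
      Algebra.subset_adjoin (Set.mem_insert _ _)
    have hj : ∀ j, j ≠ 0 → D.projOp j ∈
        Algebra.adjoin ℂ (insert (D.rightMulOp (D.cl Ω)) (D.projOp '' {i | i ≠ 0})) :=
      fun j hj => Algebra.subset_adjoin (Set.mem_insert_of_mem _ ⟨j, hj, rfl⟩)
    -- the inverse of `Ω` is a power of `Ω`, as `W̊` is finite
    have hΩ' : D.rightMulOp (D.cl Ω)⁻¹ ∈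
        Algebra.adjoin ℂ (insert (D.rightMulOp (D.cl Ω)) (D.projOp '' {i | i ≠ 0})) := by
      have hinv : (D.cl Ω)⁻¹ = D.cl Ω ^ (orderOf (D.cl Ω) - 1) := (eq_inv_of_mul_eq_one_left (by
        rw [pow_sub_one_mul (orderOf_pos _).ne', pow_orderOf_eq_one])).symm
      rw [hinv, ← AffineCartanDatum.rightMulOp_pow]
      exact pow_mem hΩ _
    rintro _ ⟨k, rfl⟩
    by_cases hk : k = 0
    · rw [hk, AffineCartanDatum.projOp_eq_conj hc h]
      exact mul_mem (mul_mem hΩ (hj i hi)) hΩ'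
    · exact hj k hk
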